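/- Let $\Gamma$ be a finite group, with the discrete topology. For a prime $p$ let $G_{\mathbb{Q}_p}$ be the absolute Galois group of $\mathbb{Q}_p$, let $I_{\mathbb{Q}_p}\subseteq G_{\mathbb{Q}_p}$ be the absolute inertia group, and let $S_{\mathbb{Q}_p,\Gamma}$ be the set of continuous homomorphisms $G_{\mathbb{Q}_p}\to\Gamma$. A counting function for $\Gamma$ is a map $c:\bigsqcup_p S_{\mathbb{Q}_p,\Gamma}\to\mathbb{Z}$ such that $c(\gamma\phi\gamma^{-1})=c(\phi)$ for all $\gamma\in\Gamma$, and $c(\phi)=0$ whenever $\phi$ is unramified, i.e. $\phi(I_{\mathbb{Q}_p})=1$. It is proper if $c(\phi)=c(\phi')$ whenever $\phi\in S_{\mathbb{Q}_p,\Gamma}$ and $\phi'\in S_{\mathbb{Q}_{p'},\Gamma}$ with primes $p,p'\nmid|\Gamma|$ (possibly equal or different) and $\phi(I_{\mathbb{Q}_p})=\phi'(I_{\mathbb{Q}_{p'}})$. The total mass of $c$ at $p$ is $$M(\mathbb{Q}_p,\Gamma,c)=\frac{1}{|\Gamma|}\sum_{\phi\in S_{\mathbb{Q}_p,\Gamma}}\frac{1}{p^{c(\phi)}}.$$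 A character Laurent polynomial is a formal finite sum $f(x)=\sum_{i=k_1}^{k_2}\sigma_i(x)x^{-i}$ with $k_1,k_2\in\mathbb{Z}$, where each $\sigma_i$ is a $\mathbb{Z}$-linear combination of complex primitive Dirichlet characters whose modulus divides $|\Gamma|$ (so every character has its smallest possible modulus, and the trivial character is the one of modulus $1$, with $\chi(x)=1$ for all $x$); a character $\chi$ of modulus $n$ takes the value $0$ at integers not coprime to $n$. A tame mass formula for $c$ is a character Laurent polynomial $f$ such that $M(\mathbb{Q}_p,\Gamma,c)=f(p)$ for every prime $p\nmid|\Gamma|$. Theorem. Let $c$ be a proper counting function for $\Gamma$. For every prime $p\nmid|\Gamma|$ the set $S_{\mathbb{Q}_p,\Gamma}$ is finite (so the sum defining the total mass at $p$ is finite). There is exactly one tame mass formula $f$ for $c$. It has the form $$f(x)=\sum_{C}\sigma_C(x)\,x^{-i_C},$$ where the sum runs over the conjugacy classes of cyclic subgroups $C\subseteq\Gamma$, each $i_C$ is an integer, and each $\sigma_C$ is a sum of distinct primitive Dirichlet characters whose modulus divides $|\Gamma|$, one of which is the trivial character. -/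

import Mathlib

noncomputable section

/-- The absolute Galois group of `ℚ_[p]`, with its Krull topology. -/
abbrev LocalGaloisGroup (p : ℕ) [Fact p.Prime] : Type :=
  PadicAlgCl p ≃ₐ[ℚ_[p]] PadicAlgCl p

/-- The ring of integers of the algebraic closure of `ℚ_[p]`: the elements of norm at most one. -/
def algClosureIntegers (p : ℕ) [Fact p.Prime] : ValuationSubring (PadicAlgCl p) :=
  (Valued.v : Valuation (PadicAlgCl p) NNReal).valuationSubring

/-- The absolute inertia group of `ℚ_[p]`: the automorphisms that act trivially on the residue
field of the ring of integers of the algebraic closure.  It is regarded as a subgroup of the whole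
absolute Galois group (which is its own decomposition group, as the norm is Galois-invariant). -/
def absoluteInertiaGroup (p : ℕ) [Fact p.Prime] : Subgroup (LocalGaloisGroup p) :=
  ((algClosureIntegers p).inertiaSubgroup ℚ_[p]).map
    ((algClosureIntegers p).decompositionSubgroup ℚ_[p]).subtype

/-- The set of continuous homomorphisms from the absolute Galois group of `ℚ_[p]` to `Γ`. -/
abbrev LocalHom (p : ℕ) [Fact p.Prime] (Γ : Type*) [Group Γ] [TopologicalSpace Γ] : Type _ :=
  LocalGaloisGroup p →ₜ* Γ

/-- The image of the absolute inertia group under a homomorphism. -/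
def inertiaImage {p : ℕ} [Fact p.Prime] {Γ : Type*} [Group Γ] [TopologicalSpace Γ]
    (φ : LocalHom p Γ) : Subgroup Γ :=
  (absoluteInertiaGroup p).map φ.toMonoidHom

/-- The conjugate homomorphism `g ↦ γ * φ g * γ⁻¹`. -/
def conjLocalHom {p : ℕ} [Fact p.Prime] {Γ : Type*} [Group Γ] [TopologicalSpace Γ]
    [DiscreteTopology Γ] (γ : Γ) (φ : LocalHom p Γ) : LocalHom p Γ where
  toMonoidHom := (MulAut.conj γ).toMonoidHom.comp φ.toMonoidHom
  continuous_toFun :=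
    (continuous_of_discreteTopology (f := fun x : Γ => γ * x * γ⁻¹)).comp φ.continuous_toFun

/-- A counting function for `Γ`: an integer-valued function on the continuous homomorphisms from
the absolute Galois groups of all the `ℚ_[p]` to `Γ` that is invariant under conjugation and
vanishes on unramified homomorphisms. -/
structure CountingFunction (Γ : Type*) [Group Γ] [TopologicalSpace Γ] [DiscreteTopology Γ] where
  toFun : ∀ (p : ℕ) [Fact p.Prime], LocalHom p Γ → ℤ
  map_conj : ∀ (p : ℕ) [Fact p.Prime] (γ : Γ) (φ : LocalHom p Γ),
    toFun p (conjLocalHom γ φ) = toFun p φ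
  map_unramified : ∀ (p : ℕ) [Fact p.Prime] (φ : LocalHom p Γ),
    inertiaImage φ = ⊥ → toFun p φ = 0

/-- A counting function is proper if at the primes not dividing the order of `Γ` it depends only
on the image of the absolute inertia group (and not on the prime). -/
def CountingFunction.IsProper {Γ : Type*} [Group Γ] [TopologicalSpace Γ] [DiscreteTopology Γ]
    (c : CountingFunction Γ) : Prop :=
  ∀ (p q : ℕ) [Fact p.Prime] [Fact q.Prime], ¬ p ∣ Nat.card Γ → ¬ q ∣ Nat.card Γ →
    ∀ (φ : LocalHom p Γ) (ψ : LocalHom q Γ), inertiaImage φ = inertiaImage ψ →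
      c.toFun p φ = c.toFun q ψ

/-- The total mass of a counting function at the prime `p`. -/
def CountingFunction.totalMass {Γ : Type*} [Group Γ] [TopologicalSpace Γ] [DiscreteTopology Γ]
    (c : CountingFunction Γ) (p : ℕ) [Fact p.Prime] : ℚ :=
  1 / (Nat.card Γ : ℚ) * ∑ᶠ φ : LocalHom p Γ, 1 / (p : ℚ) ^ c.toFun p φ

/-- The complex Dirichlet characters modulo divisors of `N` that have their smallest possible
modulus: pairs of a divisor `n` of `N` and a primitive character modulo `n`. -/
def PrimitiveCharacter (N : ℕ) : Type :=
  Σ n : {n : ℕ // n ∣ N}, {χ : DirichletCharacter ℂ n.1 // χ.IsPrimitive}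

/-- The value of a character at an integer (zero if the integer is not coprime to the modulus). -/
def PrimitiveCharacter.eval {N : ℕ} (χ : PrimitiveCharacter N) (x : ℤ) : ℂ :=
  χ.2.1 (x : ZMod χ.1.1)

/-- The trivial character: modulus `1`, value `1` at every integer. -/
def PrimitiveCharacter.trivial (N : ℕ) : PrimitiveCharacter N :=
  ⟨⟨1, one_dvd N⟩, ⟨1, DirichletCharacter.isPrimitive_one_level_one⟩⟩

/-- A character Laurent polynomial `∑ i, σ i (x) * x ^ (-i)`: finitely many coefficients `σ i`,
indexed by integers, each a `ℤ`-linear combination of Dirichlet characters modulo divisors of `N`,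
every character having its smallest possible modulus. -/
abbrev CharLaurentPolynomial (N : ℕ) : Type := ℤ →₀ (PrimitiveCharacter N →₀ ℤ)

/-- The value of a character Laurent polynomial at an integer. -/
def CharLaurentPolynomial.eval {N : ℕ} (f : CharLaurentPolynomial N) (x : ℤ) : ℂ :=
  f.sum fun i σ => (σ.sum fun χ m => (m : ℂ) * χ.eval x) * (x : ℂ) ^ (-i)

/-- `f` is a tame mass formula for `c`: it gives the total mass at every prime not dividing the
order of `Γ`. -/
def CountingFunction.IsTameMassFormula {Γ : Type*} [Group Γ] [TopologicalSpace Γ]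
    [DiscreteTopology Γ] (c : CountingFunction Γ) (f : CharLaurentPolynomial (Nat.card Γ)) :
    Prop :=
  ∀ (p : ℕ) [Fact p.Prime], ¬ p ∣ Nat.card Γ →
    ((c.totalMass p : ℚ) : ℂ) = CharLaurentPolynomial.eval f (p : ℤ)

/-- Conjugacy of cyclic subgroups. -/
def cyclicSubgroupSetoid (Γ : Type*) [Group Γ] : Setoid {C : Subgroup Γ // IsCyclic C} where
  r C D := ∃ γ : Γ, C.1.map (MulAut.conj γ).toMonoidHom = D.1
  iseqv :=
    { refl := fun C => ⟨1, by ext x; simp⟩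
      symm := by
        rintro C D ⟨γ, h⟩
        refine ⟨γ⁻¹, ?_⟩
        rw [← h, Subgroup.map_map]
        ext x
        simp [mul_assoc]
      trans := by
        rintro C D E ⟨γ, h⟩ ⟨δ, k⟩
        refine ⟨δ * γ, ?_⟩
        rw [← k, ← h, Subgroup.map_map]
        rw [map_mul]
        rfl }

/-- The conjugacy classes of cyclic subgroups of `Γ`. -/
def CyclicSubgroupClass (Γ : Type*) [Group Γ] : Type _ := Quotient (cyclicSubgroupSetoid Γ)

instance CyclicSubgroupClass.instFintype (Γ : Type*) [Group Γ] [Finite Γ] :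
    Fintype (CyclicSubgroupClass Γ) :=
  haveI : Finite (CyclicSubgroupClass Γ) := Quotient.finite (cyclicSubgroupSetoid Γ)
  Fintype.ofFinite _

end

noncomputable section

open Polynomial
open scoped Pointwise

/-! ### Inertia in terms of the norm, and the residue field of the algebraic closure. -/

section Padic

variable {p : ℕ} [Fact p.Prime]

/-! For `p` prime to `|Γ|`, every continuous homomorphism to `Γ` factors through the tame quotient.
At a finite level this quotient is generated by an inertia element `τ` and a Frobenius `F` with `F τ
F⁻¹ = τ ^ p`. Homomorphisms therefore correspond to pairs `(x, y)` in `Γ` with `y x y⁻¹ = x ^ p`,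
and the inertia image is generated by `x` (`TameGenerators.localHomEquiv`,
`TameGenerators.inertiaImage_eq`). Properness makes the exponent a function `e C` of the conjugacy
class `C` of `⟨x⟩`.

It remains to count pairs over each `C`. Let `H` be the group of units `a` modulo `|Γ|` for which `x
^ a` is conjugate to `x`. The elements whose cyclic group lies in `C` form one orbit of `Γ × (ZMod
|Γ|)ˣ`, acting by conjugation and powers. For each of them, the admissible `y` form a coset of the
centralizer if `p ∈ H`, and there are none otherwise. Orbit-stabilizer gives `|Γ| * H.index` or `0`
pairs (`CyclicSubgroupClass.card_pairs`). After division by `|Γ|`, orthogonality rewrites the index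
times the indicator of `H` as the sum of all characters trivial on `H`; the trivial character is
among them (`PrimitiveCharacter.sum_annihilator_eval`).

Uniqueness: in each unit residue class there are infinitely many primes, so each coefficient of the
difference of two formulas vanishes on that class. Linear independence of characters then makes the
coefficients zero.

The local input is elementary. The field `ℚ_p(ζ)` with `ζ` of order `p ^ f - 1` plays the unramified
part, an `N`-th root `π` of `p` the tamely ramified part, and `eq_one_of_fixes_tame_generators`
shows that wild inertia dies in `Γ`. -/

theorem PadicAlgCl.norm_galois_apply (σ : LocalGaloisGroup p) (x : PadicAlgCl p) : ‖σ x‖ = ‖x‖ :=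
  (spectralNorm_eq_of_equiv (K := ℚ_[p]) σ x).symm

theorem mem_algClosureIntegers_iff (x : PadicAlgCl p) : x ∈ algClosureIntegers p ↔ ‖x‖ ≤ 1 := by
  change (Valued.v x : NNReal) ≤ 1 ↔ _
  rw [← NNReal.coe_le_coe, PadicAlgCl.valuation_coe, NNReal.coe_one]

theorem residue_eq_zero_iff_norm_lt_one (x : algClosureIntegers p) :
    IsLocalRing.residue (algClosureIntegers p) x = 0 ↔ ‖(x : PadicAlgCl p)‖ < 1 := by
  rw [IsLocalRing.residue_eq_zero_iff]
  have := (algClosureIntegers p).valuation_lt_one_iff x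
  rw [this]
  have h2 := (Valuation.isEquiv_valuation_valuationSubring
    (Valued.v : Valuation (PadicAlgCl p) NNReal)).lt_one_iff_lt_one (x := (x : PadicAlgCl p))
  refine Iff.trans h2.symm ?_
  rw [← NNReal.coe_lt_coe, PadicAlgCl.valuation_coe, NNReal.coe_one]

theorem galois_smul_algClosureIntegers (σ : LocalGaloisGroup p) :
    σ ∈ (algClosureIntegers p).decompositionSubgroup ℚ_[p] := by
  rw [MulAction.mem_stabilizer_iff]
  ext x
  rw [ValuationSubring.mem_pointwise_smul_iff_inv_smul_mem, mem_algClosureIntegers_iff,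
    mem_algClosureIntegers_iff]
  change ‖(σ⁻¹ : LocalGaloisGroup p) x‖ ≤ 1 ↔ _
  rw [PadicAlgCl.norm_galois_apply]

theorem mem_absoluteInertiaGroup_iff (σ : LocalGaloisGroup p) :
    σ ∈ absoluteInertiaGroup p ↔ ∀ u : PadicAlgCl p, ‖u‖ ≤ 1 → ‖σ u - u‖ < 1 := by
  have key : ∀ (u : algClosureIntegers p),
      (⟨σ, galois_smul_algClosureIntegers σ⟩ :
        (algClosureIntegers p).decompositionSubgroup ℚ_[p]) •
          IsLocalRing.residue (algClosureIntegers p) u = IsLocalRing.residue _ u ↔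
      ‖σ u - u‖ < 1 := by
    intro u
    rw [← IsLocalRing.ResidueField.residue_smul, ← sub_eq_zero, ← map_sub,
      residue_eq_zero_iff_norm_lt_one]
    rfl
  constructor
  · rintro ⟨g, hg, rfl⟩ u hu
    rw [SetLike.mem_coe, ValuationSubring.inertiaSubgroup, MonoidHom.mem_ker] at hg
    exact (key ⟨u, (mem_algClosureIntegers_iff u).2 hu⟩).1
      (DFunLike.congr_fun hg (IsLocalRing.residue _ ⟨u, (mem_algClosureIntegers_iff u).2 hu⟩))
  · intro h
    refine ⟨⟨σ, galois_smul_algClosureIntegers σ⟩, ?_, rfl⟩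
    rw [SetLike.mem_coe, ValuationSubring.inertiaSubgroup, MonoidHom.mem_ker]
    ext y
    obtain ⟨u, rfl⟩ := IsLocalRing.residue_surjective y
    exact (key u).2 (h u ((mem_algClosureIntegers_iff _).1 u.2))

variable (p) in
/-- The residue field of the ring of integers of the algebraic closure of `ℚ_[p]`. -/
abbrev AlgClosureResidueField : Type := IsLocalRing.ResidueField (algClosureIntegers p)

variable (p) in
/-- The inclusion of `ℤ_[p]` into the ring of integers of the algebraic closure. -/
def padicIntToIntegers : ℤ_[p] →+* algClosureIntegers p :=
  ((algebraMap ℚ_[p] (PadicAlgCl p)).comp PadicInt.Coe.ringHom).codRestrict _ fun z => by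
    rw [mem_algClosureIntegers_iff]
    rw [RingHom.comp_apply, norm_algebraMap']
    exact z.2

theorem norm_natCast_lt_one_iff_dvd (n : ℕ) : ‖(n : PadicAlgCl p)‖ < 1 ↔ p ∣ n := by
  rw [← map_natCast (algebraMap ℚ_[p] (PadicAlgCl p)), PadicAlgCl.norm_extends,
    Padic.norm_natCast_lt_one_iff]

theorem norm_natCast_eq_one_of_not_dvd {n : ℕ} (h : ¬ p ∣ n) : ‖(n : PadicAlgCl p)‖ = 1 := by
  rw [← map_natCast (algebraMap ℚ_[p] (PadicAlgCl p)), PadicAlgCl.norm_extends]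
  refine le_antisymm (by simpa using Padic.norm_int_le_one (p := p) n) (not_lt.1 fun h' => h ?_)
  exact (Padic.norm_natCast_lt_one_iff).1 h'

instance algClosureResidueField_charP : CharP (AlgClosureResidueField p) p where
  cast_eq_zero_iff n := by
    rw [← norm_natCast_lt_one_iff_dvd, ← map_natCast (IsLocalRing.residue _),
      residue_eq_zero_iff_norm_lt_one]
    rfl

instance algClosureResidueField_algebra : Algebra (ZMod p) (AlgClosureResidueField p) :=
  ZMod.algebra _ p

theorem residue_padicInt (z : ℤ_[p]) :
    IsLocalRing.residue _ (padicIntToIntegers p z) =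
      algebraMap (ZMod p) (AlgClosureResidueField p) (PadicInt.toZMod z) := by
  have h := PadicInt.toZMod_spec z
  rw [PadicInt.maximalIdeal_eq_span_p, Ideal.mem_span_singleton] at h
  obtain ⟨w, hw⟩ := h
  have hz : z = (((PadicInt.toZMod z).val : ℕ) : ℤ_[p]) + p * w := by
    rw [← hw, ZMod.natCast_val]; ring
  conv_lhs => rw [hz]
  rw [map_add, map_add, map_mul, map_mul, map_natCast, map_natCast, map_natCast, map_natCast,
    CharP.cast_eq_zero (AlgClosureResidueField p) p, zero_mul, add_zero]
  conv_rhs => rw [← ZMod.natCast_zmod_val (PadicInt.toZMod z)]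
  rw [map_natCast]

/-- Evaluation of an integral polynomial at an element of the algebraic closure. -/
def padicEval (P : ℤ_[p][X]) (u : PadicAlgCl p) : PadicAlgCl p :=
  P.eval₂ ((algebraMap ℚ_[p] (PadicAlgCl p)).comp PadicInt.Coe.ringHom) u

theorem padicEval_eq_aeval (P : ℤ_[p][X]) (u : PadicAlgCl p) :
    padicEval P u = aeval u (P.map PadicInt.Coe.ringHom) := by
  rw [padicEval, aeval_def, eval₂_map]

theorem padicEval_galois (P : ℤ_[p][X]) (σ : LocalGaloisGroup p) (u : PadicAlgCl p) :
    padicEval P (σ u) = σ (padicEval P u) := by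
  rw [padicEval_eq_aeval, padicEval_eq_aeval]
  exact aeval_algHom_apply (σ : PadicAlgCl p →ₐ[ℚ_[p]] PadicAlgCl p) u _

/-- The bridge between characteristics: nearly being a root upstairs is the same as being a root of
the reduction. -/
theorem norm_padicEval_lt_one_iff (P : ℤ_[p][X]) (u : algClosureIntegers p) :
    ‖padicEval P (u : PadicAlgCl p)‖ < 1 ↔
      aeval (IsLocalRing.residue _ u) (P.map PadicInt.toZMod) = 0 := by
  have h1 : padicEval P (u : PadicAlgCl p) =
      ((P.eval₂ (padicIntToIntegers p) u : algClosureIntegers p) : PadicAlgCl p) := by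
    exact (Polynomial.hom_eval₂ P (padicIntToIntegers p) (algClosureIntegers p).subtype u).symm
  rw [h1, ← residue_eq_zero_iff_norm_lt_one, Polynomial.hom_eval₂, aeval_def, eval₂_map]
  have : (IsLocalRing.residue _).comp (padicIntToIntegers p) =
      (algebraMap (ZMod p) (AlgClosureResidueField p)).comp PadicInt.toZMod :=
    RingHom.ext residue_padicInt
  rw [this]

theorem exists_minpoly_lift {u : PadicAlgCl p} (hu : ‖u‖ ≤ 1) :
    ∃ P : ℤ_[p][X], P.Monic ∧ P.map PadicInt.Coe.ringHom = minpoly ℚ_[p] u := by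
  have hm : (minpoly ℚ_[p] u).Monic := minpoly.monic (Algebra.IsIntegral.isIntegral u)
  have h := (spectralValue_le_one_iff hm).1 hu
  have hl : minpoly ℚ_[p] u ∈ lifts (PadicInt.Coe.ringHom (p := p)) := by
    rw [lifts_iff_coeff_lifts]
    intro n
    exact ⟨⟨_, h n⟩, rfl⟩
  obtain ⟨q, hq, -, hq'⟩ := lifts_and_natDegree_eq_and_monic hl hm
  exact ⟨q, hq', hq⟩

end Padic

/-! ### Roots of unity of order `p ^ f - 1` and the action of Frobenius. -/

section Padic

variable {p : ℕ} [Fact p.Prime]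

theorem PadicAlgCl.norm_eq_one_of_pow_eq_one {x : PadicAlgCl p} {n : ℕ} (hn : n ≠ 0)
    (h : x ^ n = 1) : ‖x‖ = 1 := by
  have : ‖x‖ ^ n = 1 := by rw [← norm_pow, h, norm_one]
  exact (pow_eq_one_iff_of_nonneg (norm_nonneg _) hn).1 this

theorem PadicAlgCl.norm_sub_lt_trans {x y z : PadicAlgCl p} {r : ℝ} (h : ‖x - y‖ < r)
    (h' : ‖y - z‖ < r) : ‖x - z‖ < r := by
  have := IsUltrametricDist.norm_add_le_max (x - y) (y - z)
  rw [sub_add_sub_cancel] at this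
  exact this.trans_lt (max_lt h h')

theorem residue_eq_residue_iff (x y : algClosureIntegers p) :
    IsLocalRing.residue (algClosureIntegers p) x = IsLocalRing.residue _ y ↔
      ‖(x : PadicAlgCl p) - y‖ < 1 := by
  rw [← sub_eq_zero, ← map_sub, residue_eq_zero_iff_norm_lt_one]
  rfl

theorem residue_eq_one_iff (x : algClosureIntegers p) :
    IsLocalRing.residue (algClosureIntegers p) x = 1 ↔ ‖(x : PadicAlgCl p) - 1‖ < 1 := by
  rw [← map_one (IsLocalRing.residue (algClosureIntegers p)), residue_eq_residue_iff,
    OneMemClass.coe_one]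

/-- If `w ≠ 1`, then `1 + w + ... + w ^ (M - 1) = 0`. With `w` reducing to `1`, this becomes `M = 0`
in the residue field, which `p ∤ M` forbids. -/
theorem eq_one_of_pow_eq_one_of_norm_sub_lt_one {M : ℕ} (hM : M ≠ 0) (hp : ¬ p ∣ M)
    {w : PadicAlgCl p} (hw : w ^ M = 1) (h : ‖w - 1‖ < 1) : w = 1 := by
  by_contra hne
  have hn := PadicAlgCl.norm_eq_one_of_pow_eq_one hM hw
  have hsum : ∑ i ∈ Finset.range M, w ^ i = 0 := by
    have := geom_sum_mul w M
    rw [hw, sub_self] at this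
    exact (mul_eq_zero.1 this).resolve_right (sub_ne_zero.2 hne)
  lift w to algClosureIntegers p using (mem_algClosureIntegers_iff w).2 hn.le
  have h1 := (residue_eq_one_iff w).2 h
  have h2 : ∑ i ∈ Finset.range M, w ^ i = 0 := by
    apply (algClosureIntegers p).subtype_injective
    rw [map_sum, map_zero, ← hsum]
    simp only [map_pow, ValuationSubring.subtype_apply]
  have h3 := congrArg (IsLocalRing.residue (algClosureIntegers p)) h2
  rw [map_sum, map_zero] at h3
  simp only [map_pow, h1, one_pow, Finset.sum_const, Finset.card_range, nsmul_eq_mul, mul_one] at h3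
  exact hp ((CharP.cast_eq_zero_iff (AlgClosureResidueField p) p M).1 h3)

theorem eq_of_pow_eq_one_of_norm_sub_lt_one {M : ℕ} (hM : M ≠ 0) (hp : ¬ p ∣ M)
    {w v : PadicAlgCl p} (hw : w ^ M = 1) (hv : v ^ M = 1) (h : ‖w - v‖ < 1) : w = v := by
  have hn := PadicAlgCl.norm_eq_one_of_pow_eq_one hM hv
  have hv0 : v ≠ 0 := by
    rintro rfl
    simp at hn
  have : w / v = 1 := by
    refine eq_one_of_pow_eq_one_of_norm_sub_lt_one hM hp (by rw [div_pow, hw, hv, div_one]) ?_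
    rw [div_sub_one hv0, norm_div, hn, div_one]
    exact h
  exact (div_eq_one_iff_eq hv0).1 this

theorem not_dvd_pow_sub_one {f : ℕ} (hf : f ≠ 0) : ¬ p ∣ p ^ f - 1 := by
  intro h
  have hp := (Fact.out : p.Prime)
  have h1 : 1 ≤ p ^ f := Nat.one_le_pow _ _ hp.pos
  have : p ∣ 1 := by
    have := (Nat.dvd_sub (dvd_pow_self p hf) h)
    rwa [Nat.sub_sub_self h1] at this
  exact hp.one_lt.ne' (Nat.dvd_one.1 this)

theorem pow_sub_one_ne_zero_of_prime {f : ℕ} (hf : f ≠ 0) : p ^ f - 1 ≠ 0 := by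
  have := Nat.one_lt_pow hf (Fact.out : p.Prime).one_lt
  omega

/-- The element generates a field of `p ^ d` elements, with `d` the degree of its minimal
polynomial. Asking that `f` be divisible by all small `d` avoids having to know this degree. -/
theorem pow_pow_eq_self_of_aeval_eq_zero {k : Type*} [Field k] [Algebra (ZMod p) k] {y : k}
    {P : (ZMod p)[X]} (hP : P.Monic) (hy : aeval y P = 0) {f : ℕ}
    (hf : ∀ d, 1 ≤ d → d ≤ P.natDegree → d ∣ f) : y ^ p ^ f = y := by
  have hint : IsIntegral (ZMod p) y := ⟨P, hP, hy⟩
  have hdvd := hf _ (minpoly.natDegree_pos hint)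
    (natDegree_le_of_dvd (minpoly.dvd _ _ hy) hP.ne_zero)
  have := IntermediateField.adjoin.finiteDimensional hint
  have hfin : Finite (IntermediateField.adjoin (ZMod p) {y}) := Module.finite_of_finite (ZMod p)
  have := Fintype.ofFinite (IntermediateField.adjoin (ZMod p) {y})
  have hcard : Fintype.card (IntermediateField.adjoin (ZMod p) {y}) =
      p ^ (minpoly (ZMod p) y).natDegree := by
    rw [Module.card_eq_pow_finrank (K := ZMod p), ZMod.card, IntermediateField.adjoin.finrank hint]
  obtain ⟨m, rfl⟩ := hdvd
  have h1 := FiniteField.pow_card_pow m (IntermediateField.AdjoinSimple.gen (ZMod p) y)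
  rw [hcard, ← pow_mul] at h1
  simpa using congrArg (algebraMap _ k) h1

variable {f : ℕ} {ζ : PadicAlgCl p}

theorem IsPrimitiveRoot.residue_of_pow_sub_one (hf : f ≠ 0) (hζ : IsPrimitiveRoot ζ (p ^ f - 1))
    (z : algClosureIntegers p) (hz : (z : PadicAlgCl p) = ζ) :
    IsPrimitiveRoot (IsLocalRing.residue _ z) (p ^ f - 1) := by
  have hpow : z ^ (p ^ f - 1) = 1 := by
    apply Subtype.ext
    rw [SubmonoidClass.coe_pow, hz, hζ.pow_eq_one, OneMemClass.coe_one]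
  refine ⟨by rw [← map_pow, hpow, map_one], fun l hl => hζ.dvd_of_pow_eq_one l ?_⟩
  refine eq_one_of_pow_eq_one_of_norm_sub_lt_one (pow_sub_one_ne_zero_of_prime hf)
    (not_dvd_pow_sub_one hf) ?_ ?_
  · rw [← pow_mul, mul_comm, pow_mul, hζ.pow_eq_one, one_pow]
  · rw [← hz, ← SubmonoidClass.coe_pow, ← residue_eq_one_iff, map_pow, hl]

/-- The residue of `u` is `0` or a power of the residue of `ζ`, so `u` is at distance less than `1`
from `0` or a power of `ζ`. This approximation is fixed by the isometry `σ`. -/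
theorem norm_galois_sub_lt_one_of_fixes_root (hf : f ≠ 0) (hζ : IsPrimitiveRoot ζ (p ^ f - 1))
    {σ : LocalGaloisGroup p} (hσ : σ ζ = ζ) {u : PadicAlgCl p} (hu : ‖u‖ ≤ 1)
    (hd : ∀ d, 1 ≤ d → d ≤ (minpoly ℚ_[p] u).natDegree → d ∣ f) : ‖σ u - u‖ < 1 := by
  obtain ⟨P, hP, hPu⟩ := exists_minpoly_lift hu
  have hdeg : (P.map PadicInt.toZMod).natDegree = (minpoly ℚ_[p] u).natDegree := by
    rw [hP.natDegree_map, ← hPu, hP.natDegree_map]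
  lift u to algClosureIntegers p using (mem_algClosureIntegers_iff u).2 hu
  have h0 : padicEval P u = 0 := by rw [padicEval_eq_aeval, hPu, minpoly.aeval]
  have h1 : aeval (IsLocalRing.residue _ u) (P.map PadicInt.toZMod) = 0 := by
    rw [← norm_padicEval_lt_one_iff, h0, norm_zero]; exact one_pos
  have h2 := pow_pow_eq_self_of_aeval_eq_zero (hP.map _) h1 (f := f) (by rwa [hdeg])
  have hζn := PadicAlgCl.norm_eq_one_of_pow_eq_one (pow_sub_one_ne_zero_of_prime hf) hζ.pow_eq_one
  obtain ⟨z, hz⟩ : ∃ z : algClosureIntegers p, (z : PadicAlgCl p) = ζ :=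
    ⟨⟨ζ, (mem_algClosureIntegers_iff ζ).2 hζn.le⟩, rfl⟩
  have hzr := hζ.residue_of_pow_sub_one hf z hz
  have : NeZero (p ^ f - 1) := ⟨pow_sub_one_ne_zero_of_prime hf⟩
  obtain ⟨w, hw, hwσ⟩ : ∃ w : PadicAlgCl p, ‖(u : PadicAlgCl p) - w‖ < 1 ∧ σ w = w := by
    by_cases hu0 : IsLocalRing.residue _ u = 0
    · refine ⟨0, ?_, map_zero _⟩
      rw [sub_zero]
      exact (residue_eq_zero_iff_norm_lt_one u).1 hu0
    · have h3 : IsLocalRing.residue _ u ^ (p ^ f - 1) = 1 := by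
        apply mul_right_cancel₀ hu0
        rw [← pow_succ, Nat.sub_add_cancel (Nat.one_le_pow _ _ (Fact.out : p.Prime).pos), h2,
          one_mul]
      obtain ⟨i, -, hi⟩ := hzr.eq_pow_of_pow_eq_one h3
      refine ⟨ζ ^ i, ?_, by rw [map_pow, hσ]⟩
      rw [← hz]
      refine (residue_eq_zero_iff_norm_lt_one (u - z ^ i)).1 ?_
      rw [map_sub, map_pow, hi, sub_self]
  refine PadicAlgCl.norm_sub_lt_trans (y := w) ?_ (by rwa [norm_sub_rev])
  have := PadicAlgCl.norm_galois_apply σ (u - w)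
  rw [map_sub, hwσ] at this
  rwa [this]

theorem exists_zmod_polynomial_of_pow_pow_eq {k : Type*} [Field k] [CharP k p]
    [Algebra (ZMod p) k] {y : k} (hf : f ≠ 0) (hy : y ^ p ^ f = y) :
    ∃ P : (ZMod p)[X], P.map (algebraMap _ k) = ∏ j ∈ Finset.range f, (X - C (y ^ p ^ j)) := by
  set h := ∏ j ∈ Finset.range f, (X - C (y ^ p ^ j)) with hh
  have hfrob : h.map (frobenius k p) = h := by
    rw [hh, Polynomial.map_prod]
    simp only [Polynomial.map_sub, map_X, map_C, frobenius_def, ← pow_mul, ← pow_succ]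
    obtain ⟨e, rfl⟩ := Nat.exists_eq_succ_of_ne_zero hf
    -- Frobenius shifts the factors cyclically: the last one becomes the factor of `y ^ p ^ f = y`,
    -- which is the first.
    rw [Finset.prod_range_succ, Finset.prod_range_succ' (fun j => X - C (y ^ p ^ j))]
    rw [hy, pow_zero, pow_one]
  have hl : h ∈ lifts (algebraMap (ZMod p) k) := by
    rw [lifts_iff_coeff_lifts]
    intro n
    have hc : h.coeff n ^ p = h.coeff n := by
      conv_rhs => rw [← hfrob]
      rw [coeff_map, frobenius_def]
    have := (Subfield.mem_bot_iff_pow_eq_self (p := p) (F := k)).2 hc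
    have hle : (⊥ : Subfield k) ≤ (algebraMap (ZMod p) k).fieldRange := bot_le
    exact hle this
  exact hl

/-- Lift to `ℤ_[p]` the polynomial whose roots are the Frobenius conjugates of the residue of `ζ`.
It is small at `ζ`, hence at `σ ζ`, so `σ ζ` reduces to one of these conjugates. Roots of unity of
order prime to `p` are determined by their residues. -/
theorem exists_galois_apply_eq_pow_pow (hf : f ≠ 0) (hζ : IsPrimitiveRoot ζ (p ^ f - 1))
    (σ : LocalGaloisGroup p) : ∃ j < f, σ ζ = ζ ^ p ^ j := by
  have hM := pow_sub_one_ne_zero_of_prime (p := p) hf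
  have hζn := PadicAlgCl.norm_eq_one_of_pow_eq_one hM hζ.pow_eq_one
  obtain ⟨z, hz⟩ : ∃ z : algClosureIntegers p, (z : PadicAlgCl p) = ζ :=
    ⟨⟨ζ, (mem_algClosureIntegers_iff ζ).2 hζn.le⟩, rfl⟩
  obtain ⟨w, hw⟩ : ∃ z : algClosureIntegers p, (z : PadicAlgCl p) = σ ζ :=
    ⟨⟨σ ζ, (mem_algClosureIntegers_iff _).2 (by rw [PadicAlgCl.norm_galois_apply]; exact hζn.le)⟩,
      rfl⟩
  have hzr := hζ.residue_of_pow_sub_one hf z hz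
  have hy : IsLocalRing.residue _ z ^ p ^ f = IsLocalRing.residue _ z := by
    conv_lhs => rw [← Nat.sub_add_cancel (Nat.one_le_pow f p (Fact.out : p.Prime).pos)]
    rw [pow_succ, hzr.pow_eq_one, one_mul]
  obtain ⟨P, hP⟩ := exists_zmod_polynomial_of_pow_pow_eq hf hy
  obtain ⟨Q, rfl⟩ := Polynomial.map_surjective (PadicInt.toZMod (p := p))
    (ZMod.ringHom_surjective _) P
  have heval : ∀ x : AlgClosureResidueField p, aeval x (Q.map PadicInt.toZMod) =
      ∏ j ∈ Finset.range f, (x - IsLocalRing.residue _ z ^ p ^ j) := by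
    intro x
    rw [← eval_map_algebraMap, hP, eval_prod]
    simp
  have h1 : ‖padicEval Q ζ‖ < 1 := by
    rw [← hz, norm_padicEval_lt_one_iff, heval]
    exact Finset.prod_eq_zero (Finset.mem_range.2 (Nat.pos_of_ne_zero hf)) (by simp)
  have h2 : ‖padicEval Q (σ ζ)‖ < 1 := by
    rwa [padicEval_galois, PadicAlgCl.norm_galois_apply]
  rw [← hw, norm_padicEval_lt_one_iff, heval, Finset.prod_eq_zero_iff] at h2
  obtain ⟨j, hj, hj'⟩ := h2
  refine ⟨j, Finset.mem_range.1 hj, eq_of_pow_eq_one_of_norm_sub_lt_one hM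
    (not_dvd_pow_sub_one hf) (by rw [← map_pow, hζ.pow_eq_one, map_one])
    (by rw [← pow_mul, mul_comm, pow_mul, hζ.pow_eq_one, one_pow]) ?_⟩
  rw [← hw, ← hz]
  refine (residue_eq_zero_iff_norm_lt_one (w - z ^ p ^ j)).1 ?_
  rw [map_sub, map_pow, hj']

/-- The reduction of the minimal polynomial of `ζ` vanishes at the `p`-th power of the residue of
`ζ`. Hence `ζ ^ p` is close to some conjugate of `ζ`, and two such close roots of unity coincide. -/
theorem exists_galois_apply_eq_pow_prime (hf : f ≠ 0) (hζ : IsPrimitiveRoot ζ (p ^ f - 1)) :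
    ∃ σ : LocalGaloisGroup p, σ ζ = ζ ^ p := by
  have hM := pow_sub_one_ne_zero_of_prime (p := p) hf
  have hζn := PadicAlgCl.norm_eq_one_of_pow_eq_one hM hζ.pow_eq_one
  have hint : IsIntegral ℚ_[p] ζ := Algebra.IsIntegral.isIntegral ζ
  obtain ⟨P, hP, hPζ⟩ := exists_minpoly_lift hζn.le
  obtain ⟨z, hz⟩ : ∃ z : algClosureIntegers p, (z : PadicAlgCl p) = ζ :=
    ⟨⟨ζ, (mem_algClosureIntegers_iff ζ).2 hζn.le⟩, rfl⟩
  have h1 : ‖padicEval P (z : PadicAlgCl p)‖ < 1 := by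
    rw [hz, padicEval_eq_aeval, hPζ, minpoly.aeval, norm_zero]; exact one_pos
  have h2 : ‖padicEval P ((z ^ p : algClosureIntegers p) : PadicAlgCl p)‖ < 1 := by
    rw [norm_padicEval_lt_one_iff] at h1 ⊢
    rw [map_pow, ← eval_map_algebraMap]
    have := congrArg (frobenius (AlgClosureResidueField p) p) h1
    rw [aeval_def, hom_eval₂, map_zero, frobenius_def] at this
    rw [eval_map, ← this]
    congr 1
    exact Subsingleton.elim _ _
  push_cast at h2
  rw [hz, padicEval_eq_aeval, hPζ] at h2
  have hs : ((minpoly ℚ_[p] ζ).map (algebraMap ℚ_[p] (PadicAlgCl p))).Splits :=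
    IsAlgClosed.splits _
  have hprod := hs.eq_prod_roots_of_monic ((minpoly.monic hint).map _)
  rw [← eval_map_algebraMap, hprod, eval_multiset_prod, Multiset.map_map] at h2
  obtain ⟨α, hα, hα1⟩ : ∃ α ∈ ((minpoly ℚ_[p] ζ).map (algebraMap ℚ_[p] (PadicAlgCl p))).roots,
      ‖ζ ^ p - α‖ < 1 := by
    by_contra! hcon
    refine absurd h2 (not_lt.2 ?_)
    generalize ((minpoly ℚ_[p] ζ).map (algebraMap ℚ_[p] (PadicAlgCl p))).roots = s at hcon
    induction s using Multiset.induction_on with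
    | empty => simp
    | cons a s ih =>
      rw [Multiset.map_cons, Multiset.prod_cons, norm_mul]
      refine one_le_mul_of_one_le_of_one_le ?_
        (ih fun b hb => hcon b (Multiset.mem_cons_of_mem hb))
      simpa using hcon a (Multiset.mem_cons_self a s)
  have hroot : aeval α (minpoly ℚ_[p] ζ) = 0 := by
    rw [← eval_map_algebraMap]
    exact (mem_roots'.1 hα).2
  obtain ⟨σ, hσ⟩ := minpoly.exists_algEquiv_of_root' (Algebra.IsAlgebraic.isAlgebraic ζ) hroot
  refine ⟨σ, ?_⟩
  rw [hσ]
  refine (eq_of_pow_eq_one_of_norm_sub_lt_one hM (not_dvd_pow_sub_one hf) ?_ ?_ hα1).symm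
  · rw [← pow_mul, mul_comm, pow_mul, hζ.pow_eq_one, one_pow]
  · rw [← hσ, ← map_pow, hζ.pow_eq_one, map_one]

end Padic

/-! ### The value group of `ℚ_p(ζ)` and total ramification of `X ^ N - p`. -/

section Padic

variable {p : ℕ} [Fact p.Prime] {f : ℕ} {ζ : PadicAlgCl p}

theorem exists_isPrimitiveRoot_padicAlgCl {n : ℕ} (hn : n ≠ 0) :
    ∃ ζ : PadicAlgCl p, IsPrimitiveRoot ζ n := by
  have : NeZero n := ⟨hn⟩
  have : NeZero (n : PadicAlgCl p) := ⟨Nat.cast_ne_zero.2 hn⟩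
  have : HasEnoughRootsOfUnity (PadicAlgCl p) n := inferInstance
  exact this.prim

theorem exists_norm_eq_zpow {x : ℚ_[p]} (hx : x ≠ 0) : ∃ k : ℤ, ‖x‖ = (p : ℝ) ^ k :=
  ⟨_, Padic.norm_eq_zpow_neg_valuation hx⟩

theorem natDegree_minpoly_le_of_primitiveRoot (hf : f ≠ 0) (hζ : IsPrimitiveRoot ζ (p ^ f - 1)) :
    (minpoly ℚ_[p] ζ).natDegree ≤ f := by
  classical
  have hint : IsIntegral ℚ_[p] ζ := Algebra.IsIntegral.isIntegral ζ
  have hsep : (minpoly ℚ_[p] ζ).Separable := (minpoly.irreducible hint).separable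
  rw [← card_rootSet_eq_natDegree (K := PadicAlgCl p) hsep (IsAlgClosed.splits _)]
  have hsub : (minpoly ℚ_[p] ζ).rootSet (PadicAlgCl p) ⊆
      ((Finset.range f).image fun j => ζ ^ p ^ j : Finset (PadicAlgCl p)) := by
    intro α hα
    obtain ⟨σ, hσ⟩ := minpoly.exists_algEquiv_of_root' (Algebra.IsAlgebraic.isAlgebraic ζ)
      ((mem_rootSet.1 hα).2)
    obtain ⟨j, hj, hj'⟩ := exists_galois_apply_eq_pow_pow hf hζ σ
    rw [Finset.coe_image]
    exact ⟨j, by simpa using hj, by rw [← hσ, hj']⟩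
  calc _ = Set.ncard ((minpoly ℚ_[p] ζ).rootSet (PadicAlgCl p)) := by
        rw [← Nat.card_coe_set_eq, Nat.card_eq_fintype_card]
    _ ≤ _ := Set.ncard_le_ncard hsub (Finset.finite_toSet _)
    _ ≤ f := by
        rw [Set.ncard_coe_finset]
        exact Finset.card_image_le.trans (Finset.card_range f).le

theorem pow_prime_pow_injOn_of_primitiveRoot {k : Type*} [Field k] {z : k}
    (hz : IsPrimitiveRoot z (p ^ f - 1)) :
    Set.InjOn (fun j => z ^ p ^ j) (Finset.range f) := by
  intro i hi j hj hij
  rw [Finset.coe_range, Set.mem_Iio] at hi hj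
  have hp := (Fact.out : p.Prime)
  rcases Nat.lt_or_ge 1 f with h1 | h1
  · have hlt : ∀ l < f, p ^ l < p ^ f - 1 := by
      intro l hl
      have h2 : p ^ l ≤ p ^ (f - 1) := Nat.pow_le_pow_right hp.pos (by omega)
      have h3 : p ^ f = p ^ (f - 1) * p := by rw [← pow_succ]; congr 1; omega
      have h4 : p ≤ p ^ (f - 1) := Nat.le_self_pow (by omega) p
      have h5 := hp.two_le
      have h6 : p ^ (f - 1) * 2 ≤ p ^ (f - 1) * p := Nat.mul_le_mul_left _ h5
      omega
    exact Nat.pow_right_injective hp.two_le (hz.pow_inj (hlt i hi) (hlt j hj) hij)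
  · omega

/-- A root `z` would bring along its `f` distinct Frobenius conjugates, more than the degree allows.
-/
theorem aeval_residue_ne_zero_of_degree_lt {k : Type*} [Field k] [CharP k p] [Algebra (ZMod p) k]
    {z : k} (hz : IsPrimitiveRoot z (p ^ f - 1)) {P : (ZMod p)[X]} (hP : P ≠ 0)
    (hdeg : P.natDegree < f) : aeval z P ≠ 0 := by
  classical
  intro h0
  have hroot : ∀ j, aeval (z ^ p ^ j) P = 0 := by
    intro j
    have h1 := congrArg (iterateFrobenius k p j) h0
    rw [aeval_def, hom_eval₂, map_zero, iterateFrobenius_def] at h1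
    rw [aeval_def, ← h1]
    congr 1
    exact Subsingleton.elim _ _
  have hP' : P.map (algebraMap (ZMod p) k) ≠ 0 :=
    (Polynomial.map_ne_zero_iff (algebraMap (ZMod p) k).injective).2 hP
  have hsub : (Finset.range f).image (fun j => z ^ p ^ j) ⊆
      (P.map (algebraMap (ZMod p) k)).roots.toFinset := by
    intro y hy
    obtain ⟨j, -, rfl⟩ := Finset.mem_image.1 hy
    rw [Multiset.mem_toFinset, mem_roots hP', IsRoot, eval_map_algebraMap, hroot]
  have h1 := Finset.card_le_card hsub
  rw [Finset.card_image_of_injOn (pow_prime_pow_injOn_of_primitiveRoot hz),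
    Finset.card_range] at h1
  have h2 := (Multiset.toFinset_card_le _).trans (card_roots' (P.map (algebraMap (ZMod p) k)))
  rw [natDegree_map] at h2
  omega

/-- Divide by a coefficient of maximal norm. The reduction is then nonzero of degree less than `f`,
so it does not vanish at the residue of `ζ` and the quotient takes a value of norm one there. Hence
the norm sought is that of the coefficient. -/
theorem exists_norm_aeval_eq_zpow (hf : f ≠ 0) (hζ : IsPrimitiveRoot ζ (p ^ f - 1))
    {Q : ℚ_[p][X]} (hQ : Q ≠ 0) (hdeg : Q.natDegree < f) :
    ∃ k : ℤ, ‖aeval ζ Q‖ = (p : ℝ) ^ k := by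
  obtain ⟨m, hm, hmax⟩ := Q.support.exists_max_image (fun n => ‖Q.coeff n‖)
    (support_nonempty.2 hQ)
  have hc : Q.coeff m ≠ 0 := mem_support_iff.1 hm
  have hle : ∀ n, ‖((C (Q.coeff m)⁻¹ * Q).coeff n)‖ ≤ 1 := by
    intro n
    rw [coeff_C_mul, norm_mul, norm_inv, inv_mul_le_iff₀ (norm_pos_iff.2 hc), mul_one]
    by_cases hn : n ∈ Q.support
    · exact hmax n hn
    · rw [notMem_support_iff.1 hn, norm_zero]; exact norm_nonneg _
  have hl : C (Q.coeff m)⁻¹ * Q ∈ lifts (PadicInt.Coe.ringHom (p := p)) := by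
    rw [lifts_iff_coeff_lifts]
    exact fun n => ⟨⟨_, hle n⟩, rfl⟩
  obtain ⟨P, hP, hPdeg⟩ := exists_degree_eq_of_mem_lifts hl
  replace hPdeg := natDegree_eq_of_degree_eq hPdeg
  rw [natDegree_C_mul (inv_ne_zero hc)] at hPdeg
  have hcoe : P.coeff m = 1 := by
    apply Subtype.ext
    have := congrArg (fun R => R.coeff m) hP
    simp only [coeff_map, coeff_C_mul, inv_mul_cancel₀ hc] at this
    exact this
  have hP0 : P.map (PadicInt.toZMod (p := p)) ≠ 0 := by
    intro h
    have := congrArg (fun R => R.coeff m) h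
    simp [hcoe] at this
  have hζn := PadicAlgCl.norm_eq_one_of_pow_eq_one (pow_sub_one_ne_zero_of_prime hf) hζ.pow_eq_one
  obtain ⟨z, hz⟩ : ∃ z : algClosureIntegers p, (z : PadicAlgCl p) = ζ :=
    ⟨⟨ζ, (mem_algClosureIntegers_iff ζ).2 hζn.le⟩, rfl⟩
  have hne := aeval_residue_ne_zero_of_degree_lt (hζ.residue_of_pow_sub_one hf z hz) hP0
    (natDegree_map_le.trans_lt (by rwa [hPdeg]))
  rw [Ne, ← norm_padicEval_lt_one_iff, not_lt, hz] at hne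
  have hle1 : ‖padicEval P ζ‖ ≤ 1 := by
    rw [← mem_algClosureIntegers_iff]
    have : padicEval P ζ =
        ((P.eval₂ (padicIntToIntegers p) z : algClosureIntegers p) : PadicAlgCl p) := by
      rw [← hz]
      exact (Polynomial.hom_eval₂ P (padicIntToIntegers p) (algClosureIntegers p).subtype z).symm
    rw [this]
    exact Subtype.property _
  have h1 := le_antisymm hle1 hne
  rw [padicEval_eq_aeval, hP, map_mul, aeval_C, norm_mul, norm_algebraMap', norm_inv,
    inv_mul_eq_one₀ (norm_ne_zero_iff.2 hc)] at h1
  obtain ⟨k, hk⟩ := exists_norm_eq_zpow hc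
  exact ⟨k, by rw [← h1, hk]⟩

theorem exists_norm_eq_zpow_of_mem_adjoin (hf : f ≠ 0) (hζ : IsPrimitiveRoot ζ (p ^ f - 1))
    {a : PadicAlgCl p} (ha : a ∈ IntermediateField.adjoin ℚ_[p] {ζ}) (ha0 : a ≠ 0) :
    ∃ k : ℤ, ‖a‖ = (p : ℝ) ^ k := by
  have hint : IsIntegral ℚ_[p] ζ := Algebra.IsIntegral.isIntegral ζ
  have ha' : a ∈ Algebra.adjoin ℚ_[p] {ζ} := by
    rwa [← IntermediateField.adjoin_simple_toSubalgebra_of_isAlgebraic hint.isAlgebraic]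
  rw [Algebra.adjoin_singleton_eq_range_aeval] at ha'
  obtain ⟨Q, hQ⟩ := ha'
  have hmod : aeval ζ (Q %ₘ minpoly ℚ_[p] ζ) = a := by
    rw [aeval_modByMonic_eq_self_of_root (minpoly.aeval _ _)]
    exact hQ
  have hne : Q %ₘ minpoly ℚ_[p] ζ ≠ 0 := by
    intro h
    rw [h, map_zero] at hmod
    exact ha0 hmod.symm
  rw [← hmod]
  refine exists_norm_aeval_eq_zpow hf hζ hne ?_
  refine lt_of_lt_of_le ?_ (natDegree_minpoly_le_of_primitiveRoot hf hζ)
  exact natDegree_modByMonic_lt _ (minpoly.monic hint) (minpoly.ne_one _ _)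

/-- `X ^ N - p` is irreducible over `E = ℚ_p(ζ)`: a factor of degree `d` has constant term of norm
`p ^ (-d / N)`, and norms from `E` are integral powers of `p`, so `N ∣ d`. Thus `η * π` is conjugate
to `π` over `E`. -/
theorem exists_galois_fixes_root_apply_eq_mul (hf : f ≠ 0) (hζ : IsPrimitiveRoot ζ (p ^ f - 1))
    {N : ℕ} (hN : N ≠ 0) {π η : PadicAlgCl p} (hπ : π ^ N = p) (hη : η ^ N = 1) :
    ∃ σ : LocalGaloisGroup p, σ ζ = ζ ∧ σ π = η * π := by
  have hp := (Fact.out : p.Prime)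
  set E := IntermediateField.adjoin ℚ_[p] {ζ} with hE
  have hint : IsIntegral E π := Algebra.IsIntegral.isIntegral π
  set g := minpoly E π with hg
  have hmonic : g.Monic := minpoly.monic hint
  have hnormp : ‖(p : PadicAlgCl p)‖ = (p : ℝ)⁻¹ := by
    rw [← map_natCast (algebraMap ℚ_[p] (PadicAlgCl p)), PadicAlgCl.norm_extends, Padic.norm_p]
  have hqm : (X ^ N - C (p : E)).Monic := monic_X_pow_sub_C _ hN
  have hdvd : g ∣ X ^ N - C (p : E) := minpoly.dvd _ _ (by simp [hπ])
  have hnormroot : ∀ α : PadicAlgCl p, α ^ N = p → ‖α‖ = ‖π‖ := by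
    intro α hα
    refine (pow_left_inj₀ (norm_nonneg _) (norm_nonneg _) hN).1 ?_
    rw [← norm_pow, ← norm_pow, hα, hπ]
  have hcoeff : ‖algebraMap E (PadicAlgCl p) (g.coeff 0)‖ = ‖π‖ ^ g.natDegree := by
    have hs : (g.map (algebraMap E (PadicAlgCl p))).Splits := IsAlgClosed.splits _
    rw [← coeff_map, hs.coeff_zero_eq_prod_roots_of_monic (hmonic.map _), norm_mul, norm_pow,
      norm_neg, norm_one, one_pow, one_mul, ← natDegree_map (algebraMap E (PadicAlgCl p)) (p := g),
      hs.natDegree_eq_card_roots]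
    have hall : ∀ α ∈ (g.map (algebraMap E (PadicAlgCl p))).roots, ‖α‖ = ‖π‖ := by
      intro α hα
      refine hnormroot α ?_
      have h1 : aeval α g = 0 := by
        rw [← eval_map_algebraMap]
        exact (mem_roots'.1 hα).2
      have h2 := aeval_eq_zero_of_dvd_aeval_eq_zero hdvd h1
      simpa [sub_eq_zero] using h2
    generalize (g.map (algebraMap E (PadicAlgCl p))).roots = s at hall
    induction s using Multiset.induction_on with
    | empty => simp
    | cons a s ih =>
      rw [Multiset.prod_cons, norm_mul, Multiset.card_cons, pow_succ',
        hall a (Multiset.mem_cons_self a s), ih fun b hb => hall b (Multiset.mem_cons_of_mem hb)]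
  have hπ0 : ‖π‖ ≠ 0 := by
    intro h
    have : ‖π‖ ^ N = (p : ℝ)⁻¹ := by rw [← norm_pow, hπ, hnormp]
    rw [h, zero_pow hN] at this
    exact inv_ne_zero (Nat.cast_ne_zero.2 hp.ne_zero) this.symm
  have hc0 : algebraMap E (PadicAlgCl p) (g.coeff 0) ≠ 0 := by
    rw [← norm_ne_zero_iff, hcoeff]
    exact pow_ne_zero _ hπ0
  obtain ⟨k, hk⟩ := exists_norm_eq_zpow_of_mem_adjoin hf hζ (g.coeff 0).2 hc0
  have hdeg : g.natDegree = N := by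
    have h1 : ((p : ℝ) ^ k) ^ N = ((p : ℝ)⁻¹) ^ g.natDegree := by
      have hkk : ‖algebraMap E (PadicAlgCl p) (g.coeff 0)‖ = (p : ℝ) ^ k := hk
      rw [← hkk, hcoeff, ← pow_mul, mul_comm, pow_mul, ← norm_pow π N, hπ, hnormp]
    have h2 : k * N = -(g.natDegree : ℤ) := by
      rw [← zpow_natCast, ← zpow_mul, inv_pow, ← zpow_natCast, ← zpow_neg] at h1
      exact zpow_right_injective₀ (by exact_mod_cast hp.pos) (by exact_mod_cast hp.one_lt.ne') h1
    have h3 : N ∣ g.natDegree := by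
      have : (N : ℤ) ∣ -(g.natDegree : ℤ) := ⟨k, by rw [← h2, mul_comm]⟩
      exact_mod_cast (dvd_neg.1 this)
    refine le_antisymm ?_ (Nat.le_of_dvd (minpoly.natDegree_pos hint) h3)
    have := natDegree_le_of_dvd hdvd hqm.ne_zero
    rwa [natDegree_X_pow_sub_C] at this
  have hgeq : X ^ N - C (p : E) = g :=
    (eq_of_monic_of_dvd_of_natDegree_le hmonic hqm hdvd
      (by rw [natDegree_X_pow_sub_C, hdeg])).symm ▸ rfl
  have hroot : aeval (η * π) (minpoly E π) = 0 := by
    rw [← hg, ← hgeq]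
    simp [mul_pow, hη, hπ]
  have : Normal E (PadicAlgCl p) := inferInstance
  obtain ⟨σ, hσ⟩ := minpoly.exists_algEquiv_of_root' hint.isAlgebraic hroot
  refine ⟨σ.restrictScalars ℚ_[p], ?_, hσ⟩
  exact σ.commutes ⟨ζ, IntermediateField.mem_adjoin_simple_self _ ζ⟩

/-- Factorials make the exponents `p ^ n.factorial - 1` a divisibility chain, so the conditions are
nested in `n` and compactness applies to them later. -/
theorem mem_absoluteInertiaGroup_iff_fixes_roots (σ : LocalGaloisGroup p) :
    σ ∈ absoluteInertiaGroup p ↔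
      ∀ (n : ℕ) (ξ : PadicAlgCl p), ξ ^ (p ^ n.factorial - 1) = 1 → σ ξ = ξ := by
  rw [mem_absoluteInertiaGroup_iff]
  constructor
  · intro h n ξ hξ
    have hn := pow_sub_one_ne_zero_of_prime (p := p) n.factorial_ne_zero
    refine eq_of_pow_eq_one_of_norm_sub_lt_one hn (not_dvd_pow_sub_one n.factorial_ne_zero) ?_ hξ
      (h ξ (PadicAlgCl.norm_eq_one_of_pow_eq_one hn hξ).le)
    rw [← map_pow, hξ, map_one]
  · intro h u hu
    set n := (minpoly ℚ_[p] u).natDegree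
    obtain ⟨ζ, hζ⟩ := exists_isPrimitiveRoot_padicAlgCl (p := p)
      (pow_sub_one_ne_zero_of_prime (p := p) n.factorial_ne_zero)
    exact norm_galois_sub_lt_one_of_fixes_root n.factorial_ne_zero hζ (h n ζ hζ.pow_eq_one) hu
      fun d h1 h2 => Nat.dvd_factorial h1 h2

theorem isClosed_galois_apply_eq (x y : PadicAlgCl p) :
    IsClosed {σ : LocalGaloisGroup p | σ x = y} := by
  by_cases h : ∃ τ : LocalGaloisGroup p, τ x = y
  · obtain ⟨τ, hτ⟩ := h
    have : {σ : LocalGaloisGroup p | σ x = y} =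
        (fun σ => τ⁻¹ * σ) ⁻¹' (MulAction.stabilizer (LocalGaloisGroup p) x) := by
      ext σ
      simp only [Set.mem_ofPred, Set.mem_preimage, SetLike.mem_coe, MulAction.mem_stabilizer_iff]
      rw [mul_smul, inv_smul_eq_iff]
      change σ x = y ↔ σ x = τ x
      rw [hτ]
    rw [this]
    exact (Subgroup.isClosed_of_isOpen _ (stabilizer_isOpen_of_isIntegral x)).preimage
      (continuous_const_mul _)
  · convert isClosed_empty
    ext σ
    simp only [Set.mem_ofPred, Set.mem_empty_iff_false, iff_false]
    exact fun hσ => h ⟨σ, hσ⟩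

/-- The automorphisms with the right value at `π` that fix the roots of unity of level `n` form a
decreasing sequence of nonempty closed sets in a compact group. A common element lies in inertia. -/
theorem exists_mem_absoluteInertiaGroup_apply_eq_mul {N : ℕ} (hN : N ≠ 0) {π η : PadicAlgCl p}
    (hπ : π ^ N = p) (hη : η ^ N = 1) :
    ∃ σ ∈ absoluteInertiaGroup p, σ π = η * π := by
  let t : ℕ → Set (LocalGaloisGroup p) := fun n =>
    {σ | (∀ ξ : PadicAlgCl p, ξ ^ (p ^ n.factorial - 1) = 1 → σ ξ = ξ) ∧ σ π = η * π}
  have hcl : ∀ n, IsClosed (t n) := by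
    intro n
    have : t n = (⋂ ξ : {ξ : PadicAlgCl p // ξ ^ (p ^ n.factorial - 1) = 1},
        {σ : LocalGaloisGroup p | σ ξ = ξ}) ∩ {σ : LocalGaloisGroup p | σ π = η * π} := by
      ext σ
      simp [t]
    rw [this]
    exact (isClosed_iInter fun ξ => isClosed_galois_apply_eq _ _).inter
      (isClosed_galois_apply_eq _ _)
  obtain ⟨σ, hσ⟩ := IsCompact.nonempty_iInter_of_sequence_nonempty_isCompact_isClosed t
    (by
      rintro n σ ⟨h1, h2⟩
      refine ⟨fun ξ hξ => h1 ξ ?_, h2⟩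
      obtain ⟨c, hc⟩ : p ^ n.factorial - 1 ∣ p ^ (n + 1).factorial - 1 :=
        Nat.pow_sub_one_dvd_pow_sub_one _ (Nat.factorial_dvd_factorial n.le_succ)
      rw [hc, pow_mul, hξ, one_pow])
    (by
      intro n
      obtain ⟨ζ, hζ⟩ := exists_isPrimitiveRoot_padicAlgCl (p := p)
        (pow_sub_one_ne_zero_of_prime (p := p) n.factorial_ne_zero)
      obtain ⟨σ, h1, h2⟩ := exists_galois_fixes_root_apply_eq_mul n.factorial_ne_zero hζ hN hπ hη
      refine ⟨σ, fun ξ hξ => ?_, h2⟩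
      have : NeZero (p ^ n.factorial - 1) :=
        ⟨pow_sub_one_ne_zero_of_prime (p := p) n.factorial_ne_zero⟩
      obtain ⟨i, -, rfl⟩ := hζ.eq_pow_of_pow_eq_one hξ
      rw [map_pow, h1])
    (hcl 0).isCompact hcl
  rw [Set.mem_iInter] at hσ
  exact ⟨σ, (mem_absoluteInertiaGroup_iff_fixes_roots σ).2 fun n => (hσ n).1, (hσ 0).2⟩

end Padic

/-! ### Homomorphisms to groups of order prime to `p` are tame. -/

section Tame

variable {p : ℕ} [Fact p.Prime]

theorem PadicAlgCl.norm_pow_natDegree_eq (a : PadicAlgCl p) :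
    ‖a‖ ^ (minpoly ℚ_[p] a).natDegree = ‖(minpoly ℚ_[p] a).coeff 0‖ := by
  have hd : (minpoly ℚ_[p] a).natDegree ≠ 0 :=
    (minpoly.natDegree_pos (Algebra.IsIntegral.isIntegral a)).ne'
  have h := spectralNorm.spectralNorm_eq_norm_coeff_zero_rpow (K := ℚ_[p]) (L := PadicAlgCl p) a
  rw [PadicAlgCl.spectralNorm_eq] at h
  rw [h, ← Real.rpow_natCast, ← Real.rpow_mul (norm_nonneg _), one_div,
    inv_mul_cancel₀ (Nat.cast_ne_zero.2 hd), Real.rpow_one]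

theorem PadicAlgCl.exists_norm_pow_eq_zpow {a : PadicAlgCl p} (ha : a ≠ 0) {N : ℕ}
    (hN : (minpoly ℚ_[p] a).natDegree ∣ N) : ∃ k : ℤ, ‖a‖ ^ N = (p : ℝ) ^ k := by
  obtain ⟨m, rfl⟩ := hN
  obtain ⟨k, hk⟩ := exists_norm_eq_zpow
    (minpoly.coeff_zero_ne_zero (Algebra.IsIntegral.isIntegral (R := ℚ_[p]) a) ha)
  refine ⟨k * m, ?_⟩
  rw [pow_mul, PadicAlgCl.norm_pow_natDegree_eq, hk, zpow_mul, zpow_natCast]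

theorem natDegree_minpoly_dvd_finrank {a : PadicAlgCl p}
    {L : IntermediateField ℚ_[p] (PadicAlgCl p)} (ha : a ∈ L) :
    (minpoly ℚ_[p] a).natDegree ∣ Module.finrank ℚ_[p] L := by
  have hint : IsIntegral ℚ_[p] a := Algebra.IsIntegral.isIntegral a
  rw [← IntermediateField.adjoin.finrank hint]
  exact IntermediateField.finrank_dvd_of_le_right
    (IntermediateField.adjoin_simple_le_iff.2 ha)

theorem norm_prime_padicAlgCl : ‖(p : PadicAlgCl p)‖ = (p : ℝ)⁻¹ := by
  rw [← map_natCast (algebraMap ℚ_[p] (PadicAlgCl p)), PadicAlgCl.norm_extends, Padic.norm_p]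

/-- Since `‖a‖ ^ N = p ^ k`, the element `a * π ^ k` has norm one. It lies in the compositum of `L`
and `ℚ_p(π)`, of degree at most `N * N`; this is where the bound on `d` comes from. Being fixed, `π
^ k` can be divided out again. -/
theorem norm_galois_sub_lt_of_mem {N f : ℕ} (hN : N ≠ 0) (hf : f ≠ 0)
    (hd : ∀ d, 1 ≤ d → d ≤ N * N → d ∣ f) {ζ π : PadicAlgCl p}
    (hζ : IsPrimitiveRoot ζ (p ^ f - 1)) (hπ : π ^ N = p)
    {L : IntermediateField ℚ_[p] (PadicAlgCl p)} (hL : Module.finrank ℚ_[p] L ∣ N)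
    {σ : LocalGaloisGroup p} (hσζ : σ ζ = ζ) (hσπ : σ π = π) {a : PadicAlgCl p} (ha : a ∈ L)
    (ha0 : a ≠ 0) : ‖σ a - a‖ < ‖a‖ := by
  have hp := (Fact.out : p.Prime)
  obtain ⟨k, hk⟩ := PadicAlgCl.exists_norm_pow_eq_zpow ha0
    ((natDegree_minpoly_dvd_finrank ha).trans hL)
  have hπ0 : π ≠ 0 := by
    rintro rfl
    rw [zero_pow hN] at hπ
    exact Nat.cast_ne_zero.2 hp.ne_zero hπ.symm
  have hu1 : ‖a * π ^ k‖ = 1 := by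
    rw [← pow_eq_one_iff_of_nonneg (norm_nonneg _) hN, norm_mul, mul_pow, hk, ← norm_pow,
      ← zpow_natCast, ← zpow_mul, mul_comm k, zpow_mul, zpow_natCast, hπ, norm_zpow,
      norm_prime_padicAlgCl, inv_zpow, mul_inv_cancel₀]
    exact zpow_ne_zero _ (Nat.cast_ne_zero.2 hp.ne_zero)
  have hintπ : IsIntegral ℚ_[p] π := Algebra.IsIntegral.isIntegral π
  have hπdeg : Module.finrank ℚ_[p] (IntermediateField.adjoin ℚ_[p] {π}) ≤ N := by
    rw [IntermediateField.adjoin.finrank hintπ]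
    have hdvd : minpoly ℚ_[p] π ∣ X ^ N - C (p : ℚ_[p]) := minpoly.dvd _ _ (by simp [hπ])
    have := natDegree_le_of_dvd hdvd (monic_X_pow_sub_C _ hN).ne_zero
    rwa [natDegree_X_pow_sub_C] at this
  have hL0 : 0 < Module.finrank ℚ_[p] L := Nat.pos_of_dvd_of_pos hL (Nat.pos_of_ne_zero hN)
  have hudeg : (minpoly ℚ_[p] (a * π ^ k)).natDegree ≤ N * N := by
    have hmem : a * π ^ k ∈ L ⊔ IntermediateField.adjoin ℚ_[p] {π} :=
      mul_mem (le_sup_left (a := L) ha) (zpow_mem (le_sup_right (a := L)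
        (IntermediateField.mem_adjoin_simple_self _ π)) k)
    have : FiniteDimensional ℚ_[p] L := FiniteDimensional.of_finrank_pos hL0
    have := IntermediateField.adjoin.finiteDimensional hintπ
    refine (Nat.le_of_dvd Module.finrank_pos (natDegree_minpoly_dvd_finrank hmem)).trans ?_
    exact (IntermediateField.finrank_sup_le _ _).trans
      (Nat.mul_le_mul (Nat.le_of_dvd (Nat.pos_of_ne_zero hN) hL) hπdeg)
  have h := norm_galois_sub_lt_one_of_fixes_root hf hζ hσζ hu1.le
    fun d h1 h2 => hd d h1 (h2.trans hudeg)
  rw [map_mul, map_zpow₀, hσπ, ← sub_mul, norm_mul] at h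
  rw [norm_mul] at hu1
  have h0 : 0 < ‖π ^ k‖ := norm_pos_iff.2 (zpow_ne_zero _ hπ0)
  rw [← hu1] at h
  exact lt_of_mul_lt_mul_right h h0.le

theorem galois_pow_apply_sub_norm_lt {σ : LocalGaloisGroup p} {b : PadicAlgCl p}
    (hb : ‖σ b - b‖ < ‖b‖) (n : ℕ) : ‖(σ ^ n) b - b‖ < ‖b‖ := by
  induction n with
  | zero => simpa using (norm_nonneg _).trans_lt hb
  | succ n ih =>
    refine PadicAlgCl.norm_sub_lt_trans (y := σ b) ?_ hb
    rw [pow_succ', AlgEquiv.mul_apply, ← map_sub, PadicAlgCl.norm_galois_apply]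
    exact ih

/-- Work in the fixed field `L` of the kernel. If `b = σ a - a` is nonzero for some `a` in `L`, then
`∑ σ ^ i b` over `i < |Γ|` telescopes to `σ ^ |Γ| a - a = 0`. Each term is within less than `‖b‖` of
`b`, so the sum is that close to `|Γ| * b`, which has norm `‖b‖` because `p ∤ |Γ|`: a contradiction.
-/
theorem eq_one_of_fixes_tame_generators {Γ : Type*} [Group Γ] [Finite Γ] [TopologicalSpace Γ]
    [DiscreteTopology Γ] (hp : ¬ p ∣ Nat.card Γ) (φ : LocalHom p Γ) {f : ℕ} (hf : f ≠ 0)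
    (hd : ∀ d, 1 ≤ d → d ≤ Nat.card Γ * Nat.card Γ → d ∣ f) {ζ π : PadicAlgCl p}
    (hζ : IsPrimitiveRoot ζ (p ^ f - 1)) (hπ : π ^ Nat.card Γ = p)
    {σ : LocalGaloisGroup p} (hσζ : σ ζ = ζ) (hσπ : σ π = π) : φ σ = 1 := by
  have hN : Nat.card Γ ≠ 0 := Nat.card_pos.ne'
  have hcl : IsClosed (φ.toMonoidHom.ker : Set (LocalGaloisGroup p)) :=
    (isClosed_discrete ({1} : Set Γ)).preimage φ.continuous_toFun
  let U : ClosedSubgroup (LocalGaloisGroup p) := ⟨φ.toMonoidHom.ker, hcl⟩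
  set L := IntermediateField.fixedField φ.toMonoidHom.ker with hLdef
  have hfix : L.fixingSubgroup = φ.toMonoidHom.ker := InfiniteGalois.fixingSubgroup_fixedField U
  have hL : Module.finrank ℚ_[p] L ∣ Nat.card Γ := by
    rw [IntermediateField.finrank_eq_fixingSubgroup_index, hfix, Subgroup.index_ker]
    exact Subgroup.card_subgroup_dvd_card _
  have hmem : ∀ {a : PadicAlgCl p}, a ∈ L ↔ ∀ τ : LocalGaloisGroup p, φ τ = 1 → τ a = a := by
    intro a
    rw [hLdef, IntermediateField.mem_fixedField_iff]
    rfl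
  suffices h : σ ∈ φ.toMonoidHom.ker from h
  rw [← hfix, IntermediateField.mem_fixingSubgroup_iff]
  intro a ha
  by_contra hne
  have hb0 : σ a - a ≠ 0 := sub_ne_zero.2 hne
  have hσa : σ a ∈ L := by
    rw [hmem] at ha ⊢
    intro τ hτ
    have h1 := ha (σ⁻¹ * τ * σ) (by rw [map_mul, map_mul, hτ, mul_one, ← map_mul,
      inv_mul_cancel, map_one])
    have h2 := congrArg σ h1
    rw [← AlgEquiv.mul_apply, ← mul_assoc, ← mul_assoc, mul_inv_cancel, one_mul,
      AlgEquiv.mul_apply] at h2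
    exact h2
  have hlt := norm_galois_sub_lt_of_mem hN hf hd hζ hπ hL hσζ hσπ (sub_mem hσa ha) hb0
  set b := σ a - a with hb
  have hsum : ∀ m : ℕ, ∑ i ∈ Finset.range m, (σ ^ i) b = (σ ^ m) a - a := by
    intro m
    induction m with
    | zero => simp
    | succ m ih =>
      rw [Finset.sum_range_succ, ih, hb, map_sub, ← AlgEquiv.mul_apply, ← pow_succ]
      ring
  have hsum' : ∀ m : ℕ, ‖∑ i ∈ Finset.range m, (σ ^ i) b - m * b‖ < ‖b‖ := by
    intro m
    induction m with
    | zero => simpa using hb0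
    | succ m ih =>
      have : ∑ i ∈ Finset.range (m + 1), (σ ^ i) b - (m + 1 : ℕ) * b =
          (∑ i ∈ Finset.range m, (σ ^ i) b - m * b) + ((σ ^ m) b - b) := by
        rw [Finset.sum_range_succ]; push_cast; ring
      rw [this]
      exact (IsUltrametricDist.norm_add_le_max _ _).trans_lt
        (max_lt ih (galois_pow_apply_sub_norm_lt hlt m))
  have hn : (σ ^ Nat.card Γ) a = a := hmem.1 ha _ (by rw [map_pow, pow_card_eq_one'])
  have h := hsum' (Nat.card Γ)
  rw [hsum, hn, sub_self, zero_sub, norm_neg, norm_mul, norm_natCast_eq_one_of_not_dvd hp,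
    one_mul] at h
  exact lt_irrefl _ h

/-! ### Explicit tame generators and the classification of homomorphisms by pairs. -/

variable (p) in
/-- Generators of the maximal tamely ramified extension of `ℚ_[p]`, at a finite level large enough
for homomorphisms to groups of order `N`, together with a generator `τ` of the tame inertia group
and a Frobenius element `F`. -/
structure TameGenerators (N : ℕ) where
  f : ℕ
  ζ : PadicAlgCl p
  π : PadicAlgCl p
  η : PadicAlgCl p
  τ : LocalGaloisGroup p
  F : LocalGaloisGroup p
  f_ne_zero : f ≠ 0
  dvd_f : ∀ d, 1 ≤ d → d ≤ N * N → d ∣ f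
  isPrimitiveRoot_ζ : IsPrimitiveRoot ζ (p ^ f - 1)
  π_pow : π ^ N = p
  isPrimitiveRoot_η : IsPrimitiveRoot η N
  exists_η_eq : ∃ e : ℕ, η = ζ ^ e
  τ_mem : τ ∈ absoluteInertiaGroup p
  τ_ζ : τ ζ = ζ
  τ_π : τ π = η * π
  F_ζ : F ζ = ζ ^ p
  F_π : F π = π

theorem absoluteInertiaGroup_apply_eq {f : ℕ} (hf : f ≠ 0) {ζ : PadicAlgCl p}
    (hζ : ζ ^ (p ^ f - 1) = 1) {σ : LocalGaloisGroup p} (hσ : σ ∈ absoluteInertiaGroup p) :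
    σ ζ = ζ := by
  have hn := pow_sub_one_ne_zero_of_prime (p := p) hf
  refine eq_of_pow_eq_one_of_norm_sub_lt_one hn (not_dvd_pow_sub_one hf) ?_ hζ
    ((mem_absoluteInertiaGroup_iff σ).1 hσ ζ (PadicAlgCl.norm_eq_one_of_pow_eq_one hn hζ).le)
  rw [← map_pow, hζ, map_one]

theorem galois_apply_eq_root_mul {N : ℕ} (hN : N ≠ 0) {π η : PadicAlgCl p} (hπ : π ^ N = p)
    (hη : IsPrimitiveRoot η N) (σ : LocalGaloisGroup p) : ∃ i : ℕ, σ π = η ^ i * π := by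
  have : NeZero N := ⟨hN⟩
  have hπ0 : π ≠ 0 := by
    rintro rfl
    rw [zero_pow hN] at hπ
    exact Nat.cast_ne_zero.2 (Fact.out : p.Prime).ne_zero hπ.symm
  have h : (σ π / π) ^ N = 1 := by
    rw [div_pow, ← map_pow, hπ, map_natCast, div_self]
    exact Nat.cast_ne_zero.2 (Fact.out : p.Prime).ne_zero
  obtain ⟨i, -, hi⟩ := hη.eq_pow_of_pow_eq_one h
  exact ⟨i, by rw [hi, div_mul_cancel₀ _ hπ0]⟩

theorem nonempty_tameGenerators {N : ℕ} (hp : ¬ p ∣ N) : Nonempty (TameGenerators p N) := by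
  have hprime := (Fact.out : p.Prime)
  have hN : N ≠ 0 := by rintro rfl; exact hp (dvd_zero p)
  have hN1 : 1 ≤ N := Nat.one_le_iff_ne_zero.2 hN
  set f := (N * N).factorial with hfdef
  have hf : f ≠ 0 := Nat.factorial_ne_zero _
  have hdf : ∀ d, 1 ≤ d → d ≤ N * N → d ∣ f := fun d h1 h2 => Nat.dvd_factorial h1 h2
  have hM := pow_sub_one_ne_zero_of_prime (p := p) hf
  obtain ⟨ζ, hζ⟩ := exists_isPrimitiveRoot_padicAlgCl (p := p) hM
  -- The multiple `f` of all numbers up to `N * N` is also a multiple of `φ(N)`, so the `N`-th roots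
  -- of unity are powers of `ζ`.
  have hNM : N ∣ p ^ f - 1 := by
    have h1 : N.totient ∣ f := hdf _ (Nat.totient_pos.2 hN1)
      ((Nat.totient_le N).trans (Nat.le_mul_of_pos_left N hN1))
    obtain ⟨m, hm⟩ := h1
    have hcop : p.Coprime N := (Nat.Prime.coprime_iff_not_dvd hprime).2 hp
    have h2 : p ^ f ≡ 1 [MOD N] := by
      rw [hm, pow_mul]
      simpa using (Nat.ModEq.pow_totient hcop).pow m
    exact (Nat.modEq_iff_dvd' (Nat.one_le_pow _ _ hprime.pos)).1 h2.symm
  obtain ⟨e, he⟩ := hNM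
  have hη : IsPrimitiveRoot (ζ ^ e) N := by
    refine hζ.pow (Nat.pos_of_ne_zero hM) ?_
    rw [he, mul_comm]
  obtain ⟨π, hπ⟩ := IsAlgClosed.exists_pow_nat_eq (p : PadicAlgCl p) (Nat.pos_of_ne_zero hN)
  obtain ⟨τ, hτ, hτπ⟩ := exists_mem_absoluteInertiaGroup_apply_eq_mul hN hπ hη.pow_eq_one
  have hτζ := absoluteInertiaGroup_apply_eq hf hζ.pow_eq_one hτ
  obtain ⟨F, hF⟩ := exists_galois_apply_eq_pow_prime hf hζ
  obtain ⟨i, hi⟩ := galois_apply_eq_root_mul hN hπ hη F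
  have hτη : τ (ζ ^ e) = ζ ^ e := by rw [map_pow, hτζ]
  have hτpow : ∀ n : ℕ, (τ ^ n) ζ = ζ ∧ (τ ^ n) π = (ζ ^ e) ^ n * π := by
    intro n
    induction n with
    | zero => simp
    | succ n ih =>
      rw [pow_succ', AlgEquiv.mul_apply, AlgEquiv.mul_apply, ih.1, ih.2, map_mul, map_pow, hτη,
        hτπ]
      exact ⟨hτζ, by ring⟩
  -- A Frobenius `F` may send `π` to `η ^ i * π`; the factor `τ ^ ((N - 1) * i)` raises the exponent
  -- to `N * i`, which kills it without changing the action on `ζ`.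
  refine ⟨⟨f, ζ, π, ζ ^ e, τ, τ ^ ((N - 1) * i) * F, hf, hdf, hζ, hπ, hη, ⟨e, rfl⟩, hτ, hτζ, hτπ,
    ?_, ?_⟩⟩
  · rw [AlgEquiv.mul_apply, hF, map_pow, (hτpow _).1]
  · rw [AlgEquiv.mul_apply, hi, map_mul, map_pow, map_pow, (hτpow _).1, (hτpow _).2, ← mul_assoc,
      ← pow_add]
    have : i + (N - 1) * i = N * i := by
      obtain ⟨n, rfl⟩ := Nat.exists_eq_succ_of_ne_zero hN
      simp only [Nat.succ_eq_add_one, Nat.add_sub_cancel]; ring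
    rw [this, pow_mul, hη.pow_eq_one, one_pow, one_mul]

namespace TameGenerators

variable {N : ℕ} (T : TameGenerators p N)
include T

theorem ne_zero : N ≠ 0 := by
  rintro rfl
  have := T.π_pow
  rw [pow_zero] at this
  have h : (p : PadicAlgCl p) = (1 : ℕ) := by rw [← this, Nat.cast_one]
  exact (Fact.out : p.Prime).ne_one (Nat.cast_injective h)

theorem exists_apply_π (σ : LocalGaloisGroup p) : ∃ i : ℕ, σ T.π = T.η ^ i * T.π :=
  galois_apply_eq_root_mul T.ne_zero T.π_pow T.isPrimitiveRoot_η σ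

theorem exists_apply_ζ (σ : LocalGaloisGroup p) : ∃ j : ℕ, σ T.ζ = T.ζ ^ p ^ j := by
  obtain ⟨j, -, hj⟩ := exists_galois_apply_eq_pow_pow T.f_ne_zero T.isPrimitiveRoot_ζ σ
  exact ⟨j, hj⟩

theorem π_ne_zero : T.π ≠ 0 := by
  intro h
  have := T.π_pow
  rw [h, zero_pow T.ne_zero] at this
  exact Nat.cast_ne_zero.2 (Fact.out : p.Prime).ne_zero this.symm

theorem apply_η {σ : LocalGaloisGroup p} {j : ℕ} (hσ : σ T.ζ = T.ζ ^ p ^ j) :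
    σ T.η = T.η ^ p ^ j := by
  obtain ⟨e, he⟩ := T.exists_η_eq
  rw [he, map_pow, hσ, ← pow_mul, ← pow_mul, mul_comm]

theorem modEq_of_π {i i' : ℕ} (h : T.η ^ i * T.π = T.η ^ i' * T.π) : i ≡ i' [MOD N] := by
  have h1 := mul_right_cancel₀ T.π_ne_zero h
  have hpos := Nat.pos_of_ne_zero T.ne_zero
  have hmod : ∀ l, T.η ^ (l % N) = T.η ^ l := fun l => by
    conv_rhs => rw [← Nat.div_add_mod l N, pow_add, pow_mul, T.isPrimitiveRoot_η.pow_eq_one,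
      one_pow, one_mul]
  rw [← hmod i, ← hmod i'] at h1
  exact T.isPrimitiveRoot_η.pow_inj (Nat.mod_lt _ hpos) (Nat.mod_lt _ hpos) h1

theorem modEq_of_ζ {j j' : ℕ} (h : T.ζ ^ p ^ j = T.ζ ^ p ^ j') : j ≡ j' [MOD T.f] := by
  have hred : ∀ l, T.ζ ^ p ^ l = T.ζ ^ p ^ (l % T.f) := by
    intro l
    have h0 : T.ζ ^ p ^ T.f = T.ζ := by
      conv_lhs => rw [← Nat.sub_add_cancel (Nat.one_le_pow T.f p (Fact.out : p.Prime).pos)]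
      rw [pow_succ, T.isPrimitiveRoot_ζ.pow_eq_one, one_mul]
    have h1 : ∀ q, T.ζ ^ p ^ (T.f * q) = T.ζ := by
      intro q
      induction q with
      | zero => simp
      | succ q ih => rw [mul_add, mul_one, pow_add, pow_mul, ih, h0]
    conv_lhs => rw [← Nat.div_add_mod l T.f, pow_add, pow_mul, h1]
  rw [hred j, hred j'] at h
  have hlt : ∀ l, l % T.f ∈ (Finset.range T.f : Set ℕ) := by
    intro l
    simpa using Nat.mod_lt l (Nat.pos_of_ne_zero T.f_ne_zero)
  exact pow_prime_pow_injOn_of_primitiveRoot T.isPrimitiveRoot_ζ (hlt j) (hlt j') h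

theorem mul_apply_π {σ σ' : LocalGaloisGroup p} {i j i' : ℕ} (hi : σ T.π = T.η ^ i * T.π)
    (hj : σ T.ζ = T.ζ ^ p ^ j) (hi' : σ' T.π = T.η ^ i' * T.π) :
    (σ * σ') T.π = T.η ^ (i + p ^ j * i') * T.π := by
  rw [AlgEquiv.mul_apply, hi', map_mul, map_pow, T.apply_η hj, hi, ← pow_mul]
  ring

theorem mul_apply_ζ {σ σ' : LocalGaloisGroup p} {j j' : ℕ} (hj : σ T.ζ = T.ζ ^ p ^ j)
    (hj' : σ' T.ζ = T.ζ ^ p ^ j') : (σ * σ') T.ζ = T.ζ ^ p ^ (j + j') := by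
  rw [AlgEquiv.mul_apply, hj', map_pow, hj, ← pow_mul, pow_add]

theorem τ_pow_apply (n : ℕ) : (T.τ ^ n) T.ζ = T.ζ ^ p ^ 0 ∧ (T.τ ^ n) T.π = T.η ^ n * T.π := by
  induction n with
  | zero => simp
  | succ n ih =>
    have h0 : T.τ T.ζ = T.ζ ^ p ^ 0 := by simpa using T.τ_ζ
    have h1 : T.τ T.π = T.η ^ 1 * T.π := by simpa using T.τ_π
    rw [pow_succ]
    exact ⟨T.mul_apply_ζ ih.1 h0, by simpa using T.mul_apply_π ih.2 ih.1 h1⟩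

theorem F_pow_apply (n : ℕ) : (T.F ^ n) T.ζ = T.ζ ^ p ^ n ∧ (T.F ^ n) T.π = T.η ^ 0 * T.π := by
  induction n with
  | zero => simp
  | succ n ih =>
    have h0 : T.F T.ζ = T.ζ ^ p ^ 1 := by simpa using T.F_ζ
    have h1 : T.F T.π = T.η ^ 0 * T.π := by simpa using T.F_π
    rw [pow_succ]
    exact ⟨T.mul_apply_ζ ih.1 h0, by simpa using T.mul_apply_π ih.2 ih.1 h1⟩

end TameGenerators

variable {Γ : Type*} [Group Γ] [Finite Γ] [TopologicalSpace Γ] [DiscreteTopology Γ]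

/-- `σ` and `τ ^ i * F ^ j` agree on `ζ` and `π`, so their quotient is in the kernel. -/
theorem TameGenerators.localHom_apply_eq (T : TameGenerators p (Nat.card Γ))
    (hp : ¬ p ∣ Nat.card Γ) (φ : LocalHom p Γ) {σ : LocalGaloisGroup p} {i j : ℕ}
    (hi : σ T.π = T.η ^ i * T.π) (hj : σ T.ζ = T.ζ ^ p ^ j) :
    φ σ = φ T.τ ^ i * φ T.F ^ j := by
  have h1 := T.mul_apply_π (T.τ_pow_apply i).2 (T.τ_pow_apply i).1 (T.F_pow_apply j).2
  have h2 := T.mul_apply_ζ (T.τ_pow_apply i).1 (T.F_pow_apply j).1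
  rw [mul_zero, add_zero, ← hi] at h1
  rw [zero_add, ← hj] at h2
  have h := eq_one_of_fixes_tame_generators hp φ T.f_ne_zero T.dvd_f T.isPrimitiveRoot_ζ T.π_pow
    (σ := (T.τ ^ i * T.F ^ j)⁻¹ * σ)
    (by rw [AlgEquiv.mul_apply, ← h2, ← AlgEquiv.mul_apply, inv_mul_cancel, AlgEquiv.one_apply])
    (by rw [AlgEquiv.mul_apply, ← h1, ← AlgEquiv.mul_apply, inv_mul_cancel, AlgEquiv.one_apply])
  rw [map_mul, map_inv, inv_mul_eq_one, map_mul, map_pow, map_pow] at h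
  exact h.symm

theorem pow_mul_pow_of_conj_eq_pow {G : Type*} [Group G] {x y : G} {q : ℕ}
    (h : y * x * y⁻¹ = x ^ q) (i j : ℕ) : y ^ j * x ^ i = x ^ (q ^ j * i) * y ^ j := by
  have h1 : y ^ j * x * (y ^ j)⁻¹ = x ^ q ^ j := by
    induction j with
    | zero => simp
    | succ j ih =>
      rw [pow_succ', mul_inv_rev]
      calc y * y ^ j * x * ((y ^ j)⁻¹ * y⁻¹) = y * (y ^ j * x * (y ^ j)⁻¹) * y⁻¹ := by group
        _ = x ^ q ^ (j + 1) := by rw [ih, ← conj_pow, h, ← pow_mul, pow_succ']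
  rw [pow_mul, ← h1, conj_pow, inv_mul_cancel_right]

/-- Send `σ` to `x ^ i * y ^ j`, with `i` and `j` read off from its action on `π` and `ζ`. These are
defined modulo `|Γ|` and modulo `f`, which suffices as `|Γ| ∣ f`; the relation makes the map
multiplicative, and it is trivial on the open stabilizer of `ζ` and `π`. -/
theorem TameGenerators.exists_localHom (T : TameGenerators p (Nat.card Γ)) {x y : Γ}
    (h : y * x * y⁻¹ = x ^ p) : ∃ φ : LocalHom p Γ, φ T.τ = x ∧ φ T.F = y := by
  choose a ha using T.exists_apply_π
  choose b hb using T.exists_apply_ζ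
  have hNf : Nat.card Γ ∣ T.f := T.dvd_f _ Nat.card_pos (Nat.le_mul_self _)
  have hx : ∀ {i i' : ℕ}, i ≡ i' [MOD Nat.card Γ] → x ^ i = x ^ i' := fun hm =>
    pow_eq_pow_iff_modEq.2 (hm.of_dvd (orderOf_dvd_natCard x))
  have hy : ∀ {i i' : ℕ}, i ≡ i' [MOD T.f] → y ^ i = y ^ i' := fun hm =>
    pow_eq_pow_iff_modEq.2 (hm.of_dvd ((orderOf_dvd_natCard y).trans hNf))
  have hval : ∀ {σ : LocalGaloisGroup p} {i j : ℕ}, σ T.π = T.η ^ i * T.π →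
      σ T.ζ = T.ζ ^ p ^ j → x ^ a σ * y ^ b σ = x ^ i * y ^ j := by
    intro σ i j hi hj
    rw [hx (T.modEq_of_π ((ha σ).symm.trans hi)), hy (T.modEq_of_ζ ((hb σ).symm.trans hj))]
  let ψ : LocalGaloisGroup p →* Γ :=
    { toFun := fun σ => x ^ a σ * y ^ b σ
      map_one' := by
        rw [hval (σ := 1) (i := 0) (j := 0) (by simp) (by simp)]
        simp
      map_mul' := fun σ σ' => by
        rw [hval (T.mul_apply_π (ha σ) (hb σ) (ha σ')) (T.mul_apply_ζ (hb σ) (hb σ'))]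
        simp only [pow_add, mul_assoc]
        rw [← mul_assoc (y ^ b σ) (x ^ a σ'), pow_mul_pow_of_conj_eq_pow h, mul_assoc] }
  have hψ : Continuous ψ := by
    refine continuous_of_continuousAt_one ψ ?_
    rw [ContinuousAt, map_one, nhds_discrete Γ, Filter.tendsto_pure]
    have h1 := (stabilizer_isOpen_of_isIntegral (K := ℚ_[p]) T.ζ).mem_nhds
      (one_mem (MulAction.stabilizer (LocalGaloisGroup p) T.ζ))
    have h2 := (stabilizer_isOpen_of_isIntegral (K := ℚ_[p]) T.π).mem_nhds
      (one_mem (MulAction.stabilizer (LocalGaloisGroup p) T.π))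
    filter_upwards [h1, h2] with σ hσ1 hσ2
    have h3 : σ T.ζ = T.ζ := hσ1
    have h4 : σ T.π = T.π := hσ2
    change x ^ a σ * y ^ b σ = 1
    rw [hval (σ := σ) (i := 0) (j := 0) (by simpa using h4) (by simpa using h3)]
    simp
  refine ⟨⟨ψ, hψ⟩, ?_, ?_⟩
  · change x ^ a T.τ * y ^ b T.τ = x
    rw [hval (σ := T.τ) (i := 1) (j := 0) (by simpa using T.τ_π) (by simpa using T.τ_ζ)]
    simp
  · change x ^ a T.F * y ^ b T.F = y
    rw [hval (σ := T.F) (i := 0) (j := 1) (by simpa using T.F_π) (by simpa using T.F_ζ)]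
    simp

theorem TameGenerators.conj_eq_pow (T : TameGenerators p (Nat.card Γ)) (hp : ¬ p ∣ Nat.card Γ)
    (φ : LocalHom p Γ) : φ T.F * φ T.τ * (φ T.F)⁻¹ = φ T.τ ^ p := by
  have h0 : T.F T.ζ = T.ζ ^ p ^ 1 := by simpa using T.F_ζ
  have h1 : T.F T.π = T.η ^ 0 * T.π := by simpa using T.F_π
  have h2 : T.τ T.ζ = T.ζ ^ p ^ 0 := by simpa using T.τ_ζ
  have h3 : T.τ T.π = T.η ^ 1 * T.π := by simpa using T.τ_π
  have h := T.localHom_apply_eq hp φ (T.mul_apply_π h1 h0 h3) (T.mul_apply_ζ h0 h2)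
  rw [map_mul] at h
  rw [h]
  simp

theorem TameGenerators.inertiaImage_eq (T : TameGenerators p (Nat.card Γ))
    (hp : ¬ p ∣ Nat.card Γ) (φ : LocalHom p Γ) :
    inertiaImage φ = Subgroup.zpowers (φ T.τ) := by
  apply le_antisymm
  · rintro _ ⟨σ, hσ, rfl⟩
    obtain ⟨i, hi⟩ := T.exists_apply_π σ
    have hj : σ T.ζ = T.ζ ^ p ^ 0 := by
      simpa using absoluteInertiaGroup_apply_eq T.f_ne_zero T.isPrimitiveRoot_ζ.pow_eq_one hσ
    change φ σ ∈ _
    rw [T.localHom_apply_eq hp φ hi hj, pow_zero, mul_one]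
    exact Subgroup.npow_mem_zpowers _ _
  · rw [Subgroup.zpowers_le]
    exact ⟨T.τ, T.τ_mem, rfl⟩

/-- Homomorphisms from the absolute Galois group of `ℚ_[p]` to a group of order prime to `p`
correspond to pairs of elements `x`, `y` with `y x y⁻¹ = x ^ p`. -/
def TameGenerators.localHomEquiv (T : TameGenerators p (Nat.card Γ)) (hp : ¬ p ∣ Nat.card Γ) :
    LocalHom p Γ ≃ {z : Γ × Γ // z.2 * z.1 * z.2⁻¹ = z.1 ^ p} :=
  Equiv.ofBijective (fun φ => ⟨(φ T.τ, φ T.F), T.conj_eq_pow hp φ⟩) <| by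
    constructor
    · intro φ ψ h
      have h' := Prod.ext_iff.1 (Subtype.ext_iff.1 h)
      have h1 : φ T.τ = ψ T.τ := h'.1
      have h2 : φ T.F = ψ T.F := h'.2
      ext σ
      obtain ⟨i, hi⟩ := T.exists_apply_π σ
      obtain ⟨j, hj⟩ := T.exists_apply_ζ σ
      rw [T.localHom_apply_eq hp φ hi hj, T.localHom_apply_eq hp ψ hi hj, h1, h2]
    · rintro ⟨⟨x, y⟩, h⟩
      obtain ⟨φ, hx, hy⟩ := T.exists_localHom h
      exact ⟨φ, by simp [hx, hy]⟩

end Tame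

/-! ### Counting pairs with `y x y⁻¹ = x ^ a` by classes of cyclic subgroups. -/

section CyclicClasses

variable {Γ : Type*} [Group Γ]

theorem pow_eq_pow_of_zmod_eq {x : Γ} {m n : ℕ} (h : (m : ZMod (Nat.card Γ)) = n) :
    x ^ m = x ^ n :=
  pow_eq_pow_iff_modEq.2 (((ZMod.natCast_eq_natCast_iff _ _ _).1 h).of_dvd
    (orderOf_dvd_natCard x))

/-- The power of `x` by a residue class modulo the order of the group. -/
def zmodPow (x : Γ) (a : ZMod (Nat.card Γ)) : Γ := x ^ a.val

theorem zmodPow_conj (g x : Γ) (a : ZMod (Nat.card Γ)) :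
    zmodPow (g * x * g⁻¹) a = g * zmodPow x a * g⁻¹ := conj_pow

theorem map_conj_zpowers (g x : Γ) :
    (Subgroup.zpowers x).map (MulAut.conj g).toMonoidHom = Subgroup.zpowers (g * x * g⁻¹) := by
  rw [MonoidHom.map_zpowers]
  rfl

/-- The conjugacy class of the cyclic subgroup generated by an element. -/
def CyclicSubgroupClass.ofGenerator (x : Γ) : CyclicSubgroupClass Γ :=
  Quotient.mk (cyclicSubgroupSetoid Γ) ⟨Subgroup.zpowers x, inferInstance⟩

theorem CyclicSubgroupClass.ofGenerator_eq_iff {x y : Γ} :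
    CyclicSubgroupClass.ofGenerator x = CyclicSubgroupClass.ofGenerator y ↔
      ∃ g : Γ, (Subgroup.zpowers x).map (MulAut.conj g).toMonoidHom = Subgroup.zpowers y :=
  Quotient.eq (r := cyclicSubgroupSetoid Γ)

theorem CyclicSubgroupClass.ofGenerator_surjective :
    Function.Surjective (CyclicSubgroupClass.ofGenerator : Γ → CyclicSubgroupClass Γ) := by
  intro C
  obtain ⟨⟨C, hC⟩, rfl⟩ := Quotient.exists_rep C
  obtain ⟨x, hx⟩ := (Subgroup.isCyclic_iff_exists_zpowers_eq_top C).1 hC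
  subst hx
  exact ⟨x, rfl⟩

variable [Finite Γ]

instance neZero_natCard : NeZero (Nat.card Γ) := ⟨Nat.card_pos.ne'⟩

theorem zmodPow_natCast (x : Γ) (n : ℕ) : zmodPow x n = x ^ n :=
  pow_eq_pow_of_zmod_eq (by rw [ZMod.natCast_zmod_val])

theorem zmodPow_one (x : Γ) : zmodPow x 1 = x := by
  simpa using zmodPow_natCast x 1

theorem zmodPow_mul (x : Γ) (a b : ZMod (Nat.card Γ)) :
    zmodPow x (a * b) = zmodPow (zmodPow x a) b := by
  rw [zmodPow, zmodPow, zmodPow, ← pow_mul]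
  exact pow_eq_pow_of_zmod_eq (by push_cast; simp only [ZMod.natCast_zmod_val])

variable (Γ) in
/-- The action of `Γ × (ZMod |Γ|)ˣ` on `Γ` in which the first factor conjugates and the second
raises to powers.  Its orbits correspond to the conjugacy classes of cyclic subgroups. -/
@[reducible] def conjPowAction : MulAction (Γ × (ZMod (Nat.card Γ))ˣ) Γ where
  smul z x := z.1 * zmodPow x (z.2 : ZMod (Nat.card Γ)) * z.1⁻¹
  one_smul x := by
    change 1 * zmodPow x 1 * 1⁻¹ = x
    rw [zmodPow_one]; simp
  mul_smul z w x := by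
    change z.1 * w.1 * zmodPow x ((z.2 * w.2 : (ZMod (Nat.card Γ))ˣ) : ZMod (Nat.card Γ)) *
      (z.1 * w.1)⁻¹ = z.1 * zmodPow (w.1 * zmodPow x _ * w.1⁻¹) _ * z.1⁻¹
    rw [zmodPow_conj, ← zmodPow_mul, Units.val_mul, mul_comm (z.2 : ZMod (Nat.card Γ))]
    group

/-- The residue classes `a` modulo the order of the group such that `x ^ a` is conjugate
to `x`. -/
def conjPowSubgroup (x : Γ) : Subgroup (ZMod (Nat.card Γ))ˣ :=
  letI := conjPowAction Γ
  (MulAction.stabilizer (Γ × (ZMod (Nat.card Γ))ˣ) x).map (MonoidHom.snd _ _)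

theorem mem_conjPowSubgroup_iff {x : Γ} {a : (ZMod (Nat.card Γ))ˣ} :
    a ∈ conjPowSubgroup x ↔ ∃ g : Γ, g * x * g⁻¹ = zmodPow x (a : ZMod (Nat.card Γ)) := by
  constructor
  · rintro ⟨⟨g, b⟩, hz, rfl⟩
    have hz' : g * zmodPow x (b : ZMod (Nat.card Γ)) * g⁻¹ = x := hz
    refine ⟨g⁻¹, ?_⟩
    change g⁻¹ * x * g⁻¹⁻¹ = zmodPow x (b : ZMod (Nat.card Γ))
    conv_lhs => rw [← hz']
    group
  · rintro ⟨g, hg⟩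
    refine ⟨(g⁻¹, a), ?_, rfl⟩
    change g⁻¹ * zmodPow x (a : ZMod (Nat.card Γ)) * g⁻¹⁻¹ = x
    rw [← hg]
    group

/-- Project the stabilizer to the units: the kernel consists of the `(g, 1)` with `g` centralizing
`x`. -/
theorem card_centralizer_mul_card_conjPowSubgroup (x : Γ) :
    let _ := conjPowAction Γ
    Nat.card (MulAction.stabilizer (Γ × (ZMod (Nat.card Γ))ˣ) x) =
      Nat.card (Subgroup.centralizer {x}) * Nat.card (conjPowSubgroup x) := by
  let _ := conjPowAction Γ
  set S := MulAction.stabilizer (Γ × (ZMod (Nat.card Γ))ˣ) x with hS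
  set φ : S →* (ZMod (Nat.card Γ))ˣ := (MonoidHom.snd Γ (ZMod (Nat.card Γ))ˣ).comp S.subtype
  have h1 : Nat.card φ.range = Nat.card (conjPowSubgroup x) := by
    congr 1
    have : φ.range = conjPowSubgroup x := by
      rw [conjPowSubgroup, MonoidHom.range_comp, Subgroup.range_subtype]
    rw [this]
  have h2 : Nat.card φ.ker = Nat.card (Subgroup.centralizer {x}) := by
    refine Nat.card_congr ⟨fun z => ⟨z.1.1.1, ?_⟩, fun g => ⟨⟨(g.1, 1), ?_⟩, rfl⟩, ?_, ?_⟩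
    · obtain ⟨⟨⟨g, a⟩, hz⟩, ha⟩ := z
      have ha' : a = 1 := ha
      subst ha'
      have hz' : g * zmodPow x 1 * g⁻¹ = x := hz
      rw [zmodPow_one, mul_inv_eq_iff_eq_mul] at hz'
      exact Subgroup.mem_centralizer_singleton_iff.2 hz'
    · change g.1 * zmodPow x 1 * g.1⁻¹ = x
      rw [zmodPow_one, mul_inv_eq_iff_eq_mul]
      exact Subgroup.mem_centralizer_singleton_iff.1 g.2
    · rintro ⟨⟨⟨g, a⟩, hz⟩, ha⟩
      have ha' : a = 1 := ha
      subst ha'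
      rfl
    · intro g
      rfl
  rw [← h1, ← h2, ← Subgroup.index_ker, Subgroup.card_mul_index]

theorem zpowers_zmodPow_eq (x : Γ) (a : (ZMod (Nat.card Γ))ˣ) :
    Subgroup.zpowers (zmodPow x (a : ZMod (Nat.card Γ))) = Subgroup.zpowers x := by
  apply le_antisymm
  · rw [Subgroup.zpowers_le]
    exact Subgroup.npow_mem_zpowers _ _
  · rw [Subgroup.zpowers_le]
    have : zmodPow (zmodPow x (a : ZMod (Nat.card Γ)))
        ((a⁻¹ : (ZMod (Nat.card Γ))ˣ) : ZMod _) = x := by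
      rw [← zmodPow_mul, ← Units.val_mul, mul_inv_cancel, Units.val_one, zmodPow_one]
    have h2 : zmodPow (zmodPow x (a : ZMod (Nat.card Γ)))
        ((a⁻¹ : (ZMod (Nat.card Γ))ˣ) : ZMod _) ∈
          Subgroup.zpowers (zmodPow x (a : ZMod (Nat.card Γ))) :=
      Subgroup.npow_mem_zpowers _ _
    rwa [this] at h2

theorem exists_zmodPow_eq_of_zpowers_eq {x y : Γ} (h : Subgroup.zpowers y = Subgroup.zpowers x) :
    ∃ a : (ZMod (Nat.card Γ))ˣ, y = zmodPow x (a : ZMod (Nat.card Γ)) := by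
  have hy : y ∈ Subgroup.zpowers x := h ▸ Subgroup.mem_zpowers y
  obtain ⟨k, rfl⟩ := (Submonoid.mem_powers_iff _ _).1 (mem_powers_iff_mem_zpowers.2 hy)
  have hord : orderOf (x ^ k) = orderOf x := by
    rw [← Nat.card_zpowers, ← Nat.card_zpowers, h]
  have hcop : k.Coprime (orderOf x) := by
    rw [orderOf_pow] at hord
    have hpos := orderOf_pos x
    have hg := Nat.div_mul_cancel (Nat.gcd_dvd_left (orderOf x) k)
    rw [hord] at hg
    have : (orderOf x).gcd k = 1 := by
      have h1 : orderOf x * (orderOf x).gcd k = orderOf x * 1 := by rw [hg, mul_one]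
      exact Nat.eq_of_mul_eq_mul_left hpos h1
    rw [Nat.Coprime, Nat.gcd_comm, this]
  -- The exponent is a unit only modulo the order of `x`; it is lifted to a unit modulo `|Γ|` so
  -- that one group acts on all elements.
  obtain ⟨a, ha⟩ := ZMod.unitsMap_surjective (orderOf_dvd_natCard x) (ZMod.unitOfCoprime k hcop)
  refine ⟨a, pow_eq_pow_iff_modEq.2 ((ZMod.natCast_eq_natCast_iff _ _ _).1 ?_)⟩
  have h1 := congrArg (Units.val) ha
  rw [ZMod.coe_unitOfCoprime, ZMod.unitsMap_val] at h1
  rw [← h1, ZMod.natCast_val]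

theorem mem_orbit_conjPowAction_iff {x y : Γ} :
    let _ := conjPowAction Γ
    y ∈ MulAction.orbit (Γ × (ZMod (Nat.card Γ))ˣ) x ↔
      ∃ g : Γ, (Subgroup.zpowers x).map (MulAut.conj g).toMonoidHom = Subgroup.zpowers y := by
  let _ := conjPowAction Γ
  constructor
  · rintro ⟨⟨g, a⟩, rfl⟩
    refine ⟨g, ?_⟩
    change _ = Subgroup.zpowers (g * zmodPow x (a : ZMod (Nat.card Γ)) * g⁻¹)
    rw [map_conj_zpowers, ← zmodPow_conj, zpowers_zmodPow_eq]
  · rintro ⟨g, hg⟩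
    rw [map_conj_zpowers] at hg
    obtain ⟨a, ha⟩ := exists_zmodPow_eq_of_zpowers_eq hg.symm
    refine ⟨(g, a), ?_⟩
    change g * zmodPow x (a : ZMod (Nat.card Γ)) * g⁻¹ = y
    rw [ha, zmodPow_conj]

theorem card_orbit_mul_card_centralizer (x : Γ) :
    let _ := conjPowAction Γ
    Nat.card (MulAction.orbit (Γ × (ZMod (Nat.card Γ))ˣ) x) *
      Nat.card (Subgroup.centralizer {x}) = Nat.card Γ * (conjPowSubgroup x).index := by
  let _ := conjPowAction Γ
  have := Fintype.ofFinite (Γ × (ZMod (Nat.card Γ))ˣ)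
  have := Fintype.ofFinite (MulAction.orbit (Γ × (ZMod (Nat.card Γ))ˣ) x)
  have := Fintype.ofFinite (MulAction.stabilizer (Γ × (ZMod (Nat.card Γ))ˣ) x)
  have h := MulAction.card_orbit_mul_card_stabilizer_eq_card_group
    (Γ × (ZMod (Nat.card Γ))ˣ) x
  have h1 := card_centralizer_mul_card_conjPowSubgroup x
  have h2 := (conjPowSubgroup x).card_mul_index
  have hpos : 0 < Nat.card (conjPowSubgroup x) := Nat.card_pos
  simp only [← Nat.card_eq_fintype_card] at h
  rw [Nat.card_prod, h1, ← h2] at h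
  apply Nat.eq_of_mul_eq_mul_left hpos
  linarith

open Classical in
-- The solutions, if any, form a left coset of the centralizer.
theorem card_conj_eq_zmodPow (x : Γ) (a : (ZMod (Nat.card Γ))ˣ) :
    Nat.card {y : Γ // y * x * y⁻¹ = zmodPow x (a : ZMod (Nat.card Γ))} =
      if a ∈ conjPowSubgroup x then Nat.card (Subgroup.centralizer {x}) else 0 := by
  split_ifs with h
  · obtain ⟨g, hg⟩ := mem_conjPowSubgroup_iff.1 h
    refine Nat.card_congr ⟨fun y => ⟨g⁻¹ * y.1, ?_⟩, fun z => ⟨g * z.1, ?_⟩, ?_, ?_⟩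
    · rw [Subgroup.mem_centralizer_singleton_iff]
      have := y.2.trans hg.symm
      have h3 : g⁻¹ * (y.1 * x * (y.1)⁻¹) * y.1 = g⁻¹ * (g * x * g⁻¹) * y.1 := by rw [this]
      calc g⁻¹ * y.1 * x = g⁻¹ * (y.1 * x * (y.1)⁻¹) * y.1 := by group
        _ = x * (g⁻¹ * y.1) := by rw [h3]; group
    · have h3 := Subgroup.mem_centralizer_singleton_iff.1 z.2
      rw [← hg]
      calc g * z.1 * x * (g * z.1)⁻¹ = g * (z.1 * x) * (g * z.1)⁻¹ := by group
        _ = g * x * g⁻¹ := by rw [h3]; group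
    · intro y; simp
    · intro z; simp
  · rw [Nat.card_eq_zero]
    left
    exact ⟨fun y => h (mem_conjPowSubgroup_iff.2 ⟨y.1, y.2⟩)⟩

/-- Raising to a unit power is injective and commutes with conjugation and other powers, so the
equation at `y` is that at `x` with `w` conjugated. -/
theorem card_conj_eq_zmodPow_of_mem_orbit {x y : Γ} (a : (ZMod (Nat.card Γ))ˣ)
    (h : letI := conjPowAction Γ; y ∈ MulAction.orbit (Γ × (ZMod (Nat.card Γ))ˣ) x) :
    Nat.card {w : Γ // w * y * w⁻¹ = zmodPow y (a : ZMod (Nat.card Γ))} =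
      Nat.card {w : Γ // w * x * w⁻¹ = zmodPow x (a : ZMod (Nat.card Γ))} := by
  let _ := conjPowAction Γ
  obtain ⟨⟨g, b⟩, rfl⟩ := h
  change Nat.card {w : Γ // w * (g * zmodPow x (b : ZMod (Nat.card Γ)) * g⁻¹) * w⁻¹ =
    zmodPow (g * zmodPow x (b : ZMod (Nat.card Γ)) * g⁻¹) (a : ZMod (Nat.card Γ))} = _
  refine Nat.card_congr ((MulAut.conj g⁻¹).toEquiv.subtypeEquiv fun w => ?_)
  change _ ↔ (g⁻¹ * w * g⁻¹⁻¹) * x * (g⁻¹ * w * g⁻¹⁻¹)⁻¹ = _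
  rw [zmodPow_conj]
  have hinj : Function.Injective fun z : Γ => zmodPow z (b : ZMod (Nat.card Γ)) := by
    intro z z' hz
    have h2 := congrArg (fun v => zmodPow v ((b⁻¹ : (ZMod (Nat.card Γ))ˣ) : ZMod (Nat.card Γ))) hz
    simpa only [← zmodPow_mul, ← Units.val_mul, mul_inv_cancel, Units.val_one, zmodPow_one] using h2
  refine Iff.trans ?_ hinj.eq_iff
  rw [zmodPow_conj, ← zmodPow_mul, ← zmodPow_mul, mul_comm (b : ZMod (Nat.card Γ))]
  constructor
  · intro h
    calc _ = g⁻¹ * (w * (g * zmodPow x (b : ZMod (Nat.card Γ)) * g⁻¹) * w⁻¹) * g := by group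
      _ = _ := by rw [h]; group
  · intro h
    rw [← h]
    group

open Classical in
theorem card_pairs_of_orbit (x : Γ) (a : (ZMod (Nat.card Γ))ˣ) :
    Nat.card {z : Γ × Γ // (∃ g : Γ, (Subgroup.zpowers x).map (MulAut.conj g).toMonoidHom =
        Subgroup.zpowers z.1) ∧ z.2 * z.1 * z.2⁻¹ = zmodPow z.1 (a : ZMod (Nat.card Γ))} =
      Nat.card Γ * if a ∈ conjPowSubgroup x then (conjPowSubgroup x).index else 0 := by
  let _ := conjPowAction Γ
  have e : {z : Γ × Γ // (∃ g : Γ, (Subgroup.zpowers x).map (MulAut.conj g).toMonoidHom =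
      Subgroup.zpowers z.1) ∧ z.2 * z.1 * z.2⁻¹ = zmodPow z.1 (a : ZMod (Nat.card Γ))} ≃
      Σ y : MulAction.orbit (Γ × (ZMod (Nat.card Γ))ˣ) x,
        {w : Γ // w * y * w⁻¹ = zmodPow (y : Γ) (a : ZMod (Nat.card Γ))} :=
    { toFun := fun z => ⟨⟨z.1.1, mem_orbit_conjPowAction_iff.2 z.2.1⟩, ⟨z.1.2, z.2.2⟩⟩
      invFun := fun t => ⟨(t.1.1, t.2.1), mem_orbit_conjPowAction_iff.1 t.1.2, t.2.2⟩
      left_inv := fun _ => rfl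
      right_inv := fun _ => rfl }
  have := Fintype.ofFinite (MulAction.orbit (Γ × (ZMod (Nat.card Γ))ˣ) x)
  rw [Nat.card_congr e, Nat.card_sigma,
    Finset.sum_congr rfl fun y _ => card_conj_eq_zmodPow_of_mem_orbit a y.2,
    Finset.sum_const, Finset.card_univ, ← Nat.card_eq_fintype_card, card_conj_eq_zmodPow,
    smul_eq_mul, mul_ite, mul_ite, mul_zero, mul_zero, card_orbit_mul_card_centralizer]

/-- The residue classes `a` modulo the order of the group such that a generator of a cyclic
subgroup in the class is conjugate to its `a`-th power. -/
def CyclicSubgroupClass.powSubgroup (C : CyclicSubgroupClass Γ) : Subgroup (ZMod (Nat.card Γ))ˣ :=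
  conjPowSubgroup (CyclicSubgroupClass.ofGenerator_surjective C).choose

open Classical in
theorem CyclicSubgroupClass.card_pairs (C : CyclicSubgroupClass Γ) (a : (ZMod (Nat.card Γ))ˣ) :
    Nat.card {z : Γ × Γ // z.2 * z.1 * z.2⁻¹ = zmodPow z.1 (a : ZMod (Nat.card Γ)) ∧
        CyclicSubgroupClass.ofGenerator z.1 = C} =
      Nat.card Γ * if a ∈ C.powSubgroup then C.powSubgroup.index else 0 := by
  have hx := (CyclicSubgroupClass.ofGenerator_surjective C).choose_spec
  rw [CyclicSubgroupClass.powSubgroup, ← card_pairs_of_orbit]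
  refine Nat.card_congr (Equiv.subtypeEquivRight fun z => ?_)
  rw [← CyclicSubgroupClass.ofGenerator_eq_iff, hx, and_comm, eq_comm (a := C)]

end CyclicClasses

/-! ### Primitive characters, orthogonality, and uniqueness of character Laurent polynomials. -/

section Characters

variable {N : ℕ}

/-- The Dirichlet character modulo `N` induced by a primitive character modulo a divisor
of `N`. -/
def PrimitiveCharacter.toLevel (χ : PrimitiveCharacter N) : DirichletCharacter ℂ N :=
  DirichletCharacter.changeLevel χ.1.2 χ.2.1

/-- The primitive character that induces a Dirichlet character modulo `N`. -/
def PrimitiveCharacter.ofLevel (χ : DirichletCharacter ℂ N) : PrimitiveCharacter N :=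
  ⟨⟨χ.conductor, χ.conductor_dvd_level⟩, ⟨χ.primitiveCharacter, χ.primitiveCharacter_isPrimitive⟩⟩

theorem PrimitiveCharacter.toLevel_ofLevel (χ : DirichletCharacter ℂ N) :
    (PrimitiveCharacter.ofLevel χ).toLevel = χ :=
  χ.changeLevel_primitiveCharacter

theorem PrimitiveCharacter.toLevel_injective [NeZero N] :
    Function.Injective (PrimitiveCharacter.toLevel (N := N)) := by
  rintro ⟨⟨n, hn⟩, ⟨χ, hχ⟩⟩ ⟨⟨m, hm⟩, ⟨ψ, hψ⟩⟩ h
  change DirichletCharacter.changeLevel hn χ = DirichletCharacter.changeLevel hm ψ at h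
  have h1 := congrArg DirichletCharacter.conductor h
  rw [DirichletCharacter.conductor_changeLevel, DirichletCharacter.conductor_changeLevel, hχ,
    hψ] at h1
  subst h1
  obtain rfl := DirichletCharacter.changeLevel_injective hn h
  rfl

/-- Primitive characters of modulus dividing `N` correspond to Dirichlet characters modulo `N`. -/
def PrimitiveCharacter.equivLevel [NeZero N] : PrimitiveCharacter N ≃ DirichletCharacter ℂ N :=
  ⟨PrimitiveCharacter.toLevel, PrimitiveCharacter.ofLevel,
    fun _ => PrimitiveCharacter.toLevel_injective (PrimitiveCharacter.toLevel_ofLevel _),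
    PrimitiveCharacter.toLevel_ofLevel⟩

instance PrimitiveCharacter.instFinite [NeZero N] : Finite (PrimitiveCharacter N) :=
  Finite.of_equiv _ PrimitiveCharacter.equivLevel.symm

theorem PrimitiveCharacter.toLevel_trivial : (PrimitiveCharacter.trivial N).toLevel = 1 :=
  DirichletCharacter.changeLevel_one _

theorem PrimitiveCharacter.eval_eq_toLevel (χ : PrimitiveCharacter N) {p : ℕ}
    (hp : p.Coprime N) : χ.eval p = χ.toLevel (p : ZMod N) := by
  have h : IsCoprime (p : ℤ) N := Nat.isCoprime_iff_coprime.2 hp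
  have := DirichletCharacter.changeLevel_eq_cast_of_dvd' χ.2.1 χ.1.2 h
  rw [PrimitiveCharacter.eval, PrimitiveCharacter.toLevel]
  push_cast at this ⊢
  exact this.symm

open Classical in
theorem DirichletCharacter.sum_subgroup_eq [NeZero N] (H : Subgroup (ZMod N)ˣ)
    (χ : DirichletCharacter ℂ N) :
    ∑ a : H, χ (a : (ZMod N)ˣ) = if ∀ a ∈ H, χ (a : ZMod N) = 1 then (Nat.card H : ℂ) else 0 := by
  split_ifs with h
  · rw [Finset.sum_congr rfl fun (a : H) _ => h a a.2]
    simp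
  · push Not at h
    obtain ⟨b, hb, hχ⟩ := h
    have h1 : χ (b : ZMod N) * ∑ a : H, χ (a : (ZMod N)ˣ) = ∑ a : H, χ (a : (ZMod N)ˣ) := by
      rw [Finset.mul_sum]
      refine Fintype.sum_equiv (Equiv.mulLeft (⟨b, hb⟩ : H)) _ _ fun a => ?_
      rw [← map_mul]
      rfl
    by_contra hne
    exact hχ (mul_eq_right₀ hne |>.1 h1)

open Classical in
-- Sum `χ (a * u)` over all `χ` and all `a ∈ H` in both orders. Summing over `a` first selects the
-- `χ` trivial on `H`; summing over `χ` first selects `a = u⁻¹`.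
theorem DirichletCharacter.sum_annihilator_eq [NeZero N] (H : Subgroup (ZMod N)ˣ) (u : (ZMod N)ˣ) :
    ∑ χ : DirichletCharacter ℂ N with ∀ a ∈ H, χ (a : ZMod N) = 1, χ (u : ZMod N) =
      if u ∈ H then (H.index : ℂ) else 0 := by
  have hpos : (Nat.card H : ℂ) ≠ 0 := Nat.cast_ne_zero.2 Nat.card_pos.ne'
  apply mul_left_cancel₀ hpos
  have h1 : (Nat.card H : ℂ) *
      ∑ χ : DirichletCharacter ℂ N with ∀ a ∈ H, χ (a : ZMod N) = 1, χ (u : ZMod N) =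
      ∑ χ : DirichletCharacter ℂ N, ∑ a : H, χ ((a : (ZMod N)ˣ) * u : ZMod N) := by
    rw [Finset.sum_filter, Finset.mul_sum]
    refine Finset.sum_congr rfl fun χ _ => ?_
    simp only [map_mul]
    rw [← Finset.sum_mul, DirichletCharacter.sum_subgroup_eq]
    split_ifs <;> simp
  rw [h1, Finset.sum_comm]
  have h2 : ∀ a : H, ∑ χ : DirichletCharacter ℂ N, χ ((a : (ZMod N)ˣ) * u : ZMod N) =
      if (a : (ZMod N)ˣ) = u⁻¹ then (N.totient : ℂ) else 0 := by
    intro a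
    rw [DirichletCharacter.sum_characters_eq]
    refine if_congr ?_ rfl rfl
    rw [← Units.val_mul, Units.val_eq_one, mul_eq_one_iff_eq_inv]
  rw [Finset.sum_congr rfl fun a _ => h2 a]
  have hindex : (N.totient : ℂ) = Nat.card H * H.index := by
    rw [← Nat.cast_mul, Subgroup.card_mul_index, Nat.card_eq_fintype_card, ZMod.card_units_eq_totient]
  split_ifs with hu
  · rw [Finset.sum_eq_single (⟨u⁻¹, H.inv_mem hu⟩ : H)]
    · rw [if_pos rfl, hindex]
    · intro b _ hb
      exact if_neg fun h => hb (Subtype.ext h)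
    · intro h
      exact absurd (Finset.mem_univ _) h
  · rw [mul_zero]
    refine Finset.sum_eq_zero fun a _ => if_neg fun h => hu ?_
    rw [← H.inv_mem_iff, ← h]
    exact a.2

/-- The primitive characters of modulus dividing `N` that are trivial on a subgroup of the units
modulo `N`. -/
def PrimitiveCharacter.annihilator [NeZero N] (H : Subgroup (ZMod N)ˣ) :
    Finset (PrimitiveCharacter N) :=
  (Set.toFinite {χ : PrimitiveCharacter N | ∀ a ∈ H, χ.toLevel (a : ZMod N) = 1}).toFinset

theorem PrimitiveCharacter.mem_annihilator [NeZero N] {H : Subgroup (ZMod N)ˣ}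
    {χ : PrimitiveCharacter N} :
    χ ∈ PrimitiveCharacter.annihilator H ↔ ∀ a ∈ H, χ.toLevel (a : ZMod N) = 1 := by
  simp [PrimitiveCharacter.annihilator]

theorem PrimitiveCharacter.trivial_mem_annihilator [NeZero N] (H : Subgroup (ZMod N)ˣ) :
    PrimitiveCharacter.trivial N ∈ PrimitiveCharacter.annihilator H := by
  rw [PrimitiveCharacter.mem_annihilator, PrimitiveCharacter.toLevel_trivial]
  exact fun a _ => MulChar.one_apply_coe a

open Classical in
theorem PrimitiveCharacter.sum_annihilator_eval [NeZero N] (H : Subgroup (ZMod N)ˣ) {p : ℕ}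
    (hp : p.Coprime N) : ∑ χ ∈ PrimitiveCharacter.annihilator H, χ.eval p =
      if ZMod.unitOfCoprime p hp ∈ H then (H.index : ℂ) else 0 := by
  rw [← DirichletCharacter.sum_annihilator_eq]
  refine Finset.sum_equiv PrimitiveCharacter.equivLevel (fun χ => ?_) fun χ _ => ?_
  · rw [PrimitiveCharacter.mem_annihilator, Finset.mem_filter]
    simp [PrimitiveCharacter.equivLevel]
  · rw [PrimitiveCharacter.eval_eq_toLevel χ hp]
    rfl

/-- The value of a combination of primitive characters at a residue class modulo `N`. -/
def PrimitiveCharacter.levelSum (σ : PrimitiveCharacter N →₀ ℤ) (a : ZMod N) : ℂ :=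
  σ.sum fun χ m => (m : ℂ) * χ.toLevel a

/-- Raised to the common level `N`, distinct primitive characters remain distinct and all vanish off
the units, so Dedekind's independence of monoid homomorphisms applies on all of `ZMod N`. -/
theorem PrimitiveCharacter.eq_zero_of_levelSum_eq_zero [NeZero N] {σ : PrimitiveCharacter N →₀ ℤ}
    (h : ∀ a : (ZMod N)ˣ, PrimitiveCharacter.levelSum σ (a : ZMod N) = 0) : σ = 0 := by
  have hli := linearIndependent_monoidHom (ZMod N) ℂ
  have hinj : Function.Injective fun χ : PrimitiveCharacter N => χ.toLevel.toMonoidHom := by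
    intro χ ψ hχψ
    refine PrimitiveCharacter.toLevel_injective (MulChar.ext fun a => ?_)
    exact DFunLike.congr_fun hχψ (a : ZMod N)
  have hli' := hli.comp _ hinj
  rw [linearIndependent_iff'] at hli'
  have h0 : ∑ χ ∈ σ.support, ((σ χ : ℤ) : ℂ) • (χ.toLevel.toMonoidHom : ZMod N → ℂ) = 0 := by
    funext a
    rw [Finset.sum_apply, Pi.zero_apply]
    by_cases ha : IsUnit a
    · obtain ⟨a, rfl⟩ := ha
      exact h a
    · refine Finset.sum_eq_zero fun χ _ => ?_
      change (σ χ : ℂ) * χ.toLevel a = 0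
      rw [MulChar.map_nonunit _ ha, mul_zero]
  ext χ
  by_cases hχ : χ ∈ σ.support
  · exact_mod_cast hli' σ.support (fun χ => ((σ χ : ℤ) : ℂ)) h0 χ hχ
  · simpa using hχ

theorem CharLaurentPolynomial.eval_eq_levelSum (f : CharLaurentPolynomial N) {p : ℕ}
    (hp : p.Coprime N) : f.eval p =
      f.sum fun i σ => PrimitiveCharacter.levelSum σ (p : ZMod N) * (p : ℂ) ^ (-i) := by
  rw [CharLaurentPolynomial.eval]
  refine Finset.sum_congr rfl fun i _ => ?_
  simp only [PrimitiveCharacter.levelSum, PrimitiveCharacter.eval_eq_toLevel _ hp, Int.cast_natCast]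

theorem CharLaurentPolynomial.eval_single (i : ℤ) (σ : PrimitiveCharacter N →₀ ℤ) (x : ℤ) :
    CharLaurentPolynomial.eval (Finsupp.single i σ) x =
      (σ.sum fun χ m => (m : ℂ) * χ.eval x) * (x : ℂ) ^ (-i) := by
  rw [CharLaurentPolynomial.eval, Finsupp.sum_single_index]
  simp

theorem CharLaurentPolynomial.eval_add (f g : CharLaurentPolynomial N) (x : ℤ) :
    (f + g).eval x = f.eval x + g.eval x := by
  rw [CharLaurentPolynomial.eval, Finsupp.sum_add_index']
  · rfl
  · simp
  · intro i σ τ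
    rw [Finsupp.sum_add_index', add_mul]
    · simp
    · intro χ m n
      push_cast
      ring

/-- Evaluation of character Laurent polynomials at an integer as an additive homomorphism. -/
def CharLaurentPolynomial.evalHom (x : ℤ) : CharLaurentPolynomial N →+ ℂ :=
  AddMonoidHom.mk' (fun f => f.eval x) fun f g => CharLaurentPolynomial.eval_add f g x

theorem laurent_coeff_eq_zero_of_infinite {s : Finset ℤ} {c : ℤ → ℂ} {P : Set ℕ}
    (hP : P.Infinite) (hpos : ∀ n ∈ P, n ≠ 0)
    (h : ∀ n ∈ P, ∑ i ∈ s, c i * (n : ℂ) ^ (-i) = 0) : ∀ i ∈ s, c i = 0 := by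
  obtain ⟨b, hb⟩ := s.finite_toSet.bddAbove
  -- Multiplying by `n ^ b`, with `b` an upper bound of the exponents, leaves a genuine polynomial
  -- with infinitely many roots.
  let Q : Polynomial ℂ := ∑ i ∈ s, Polynomial.monomial (b - i).toNat (c i)
  have hQ : Q = 0 := by
    refine Polynomial.eq_zero_of_infinite_isRoot Q ?_
    refine (hP.image (f := fun n : ℕ => (n : ℂ)) Nat.cast_injective.injOn).mono ?_
    rintro _ ⟨n, hn, rfl⟩
    have hn0 : (n : ℂ) ≠ 0 := Nat.cast_ne_zero.2 (hpos n hn)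
    change Polynomial.eval (n : ℂ) Q = 0
    rw [Polynomial.eval_finsetSum]
    have : ∑ i ∈ s, Polynomial.eval (n : ℂ) (Polynomial.monomial (b - i).toNat (c i)) =
        (n : ℂ) ^ b * ∑ i ∈ s, c i * (n : ℂ) ^ (-i) := by
      rw [Finset.mul_sum]
      refine Finset.sum_congr rfl fun i hi => ?_
      rw [Polynomial.eval_monomial, ← zpow_natCast,
        Int.toNat_of_nonneg (sub_nonneg.2 (hb (Finset.mem_coe.2 hi))), sub_eq_add_neg,
        zpow_add₀ hn0]
      ring
    rw [this, h n hn, mul_zero]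
  intro i hi
  have hcoeff := congrArg (fun R => Polynomial.coeff R (b - i).toNat) hQ
  simp only [Q, Polynomial.finsetSum_coeff, Polynomial.coeff_monomial,
    Polynomial.coeff_zero] at hcoeff
  rw [Finset.sum_eq_single i] at hcoeff
  · simpa using hcoeff
  · intro j hj hji
    refine if_neg fun heq => hji ?_
    have h1 : (0 : ℤ) ≤ b - i := sub_nonneg.2 (hb (Finset.mem_coe.2 hi))
    have h2 : (0 : ℤ) ≤ b - j := sub_nonneg.2 (hb (Finset.mem_coe.2 hj))
    omega
  · exact fun hni => absurd hi hni

/-- On the primes congruent to `a` the coefficients are constants, and by Dirichlet's theorem there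
are infinitely many such primes. -/
theorem CharLaurentPolynomial.eq_zero_of_eval_prime_eq_zero [NeZero N]
    {f : CharLaurentPolynomial N} (h : ∀ p : ℕ, p.Prime → ¬ p ∣ N → f.eval p = 0) : f = 0 := by
  ext1 i
  by_contra hi
  have hi' : i ∈ f.support := Finsupp.mem_support_iff.2 hi
  refine hi (PrimitiveCharacter.eq_zero_of_levelSum_eq_zero fun a => ?_)
  have hinf := Nat.infinite_setOfPred_prime_and_eq_mod (q := N) (a := (a : ZMod N)) a.isUnit
  refine laurent_coeff_eq_zero_of_infinite (s := f.support)
    (c := fun i => PrimitiveCharacter.levelSum (f i) (a : ZMod N)) hinf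
    (fun n hn => hn.1.ne_zero) ?_ i hi'
  rintro p ⟨hp, hpa⟩
  have hcop : p.Coprime N := by
    rw [← ZMod.isUnit_iff_coprime, hpa]
    exact a.isUnit
  have h1 := h p hp ((Nat.Prime.coprime_iff_not_dvd hp).1 hcop)
  rw [CharLaurentPolynomial.eval_eq_levelSum f hcop, hpa] at h1
  exact h1

end Characters

/-! ### Assembling the mass formula. -/

section MassFormula

section

variable {Γ : Type*} [Group Γ] [Finite Γ]

/-- The mass formula attached to a choice of exponents for the conjugacy classes of cyclic
subgroups. -/
def massFormula (e : CyclicSubgroupClass Γ → ℤ) : CharLaurentPolynomial (Nat.card Γ) :=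
  ∑ C : CyclicSubgroupClass Γ, Finsupp.single (e C)
    (∑ χ ∈ PrimitiveCharacter.annihilator C.powSubgroup, Finsupp.single χ (1 : ℤ))

open Classical in
theorem eval_massFormula (e : CyclicSubgroupClass Γ → ℤ) {p : ℕ}
    (hcop : p.Coprime (Nat.card Γ)) : (massFormula e).eval p = ∑ C : CyclicSubgroupClass Γ,
      (if ZMod.unitOfCoprime p hcop ∈ C.powSubgroup then (C.powSubgroup.index : ℂ) else 0) *
        (p : ℂ) ^ (-e C) := by
  change CharLaurentPolynomial.evalHom (p : ℤ) (massFormula e) = _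
  rw [massFormula, map_sum]
  refine Finset.sum_congr rfl fun C _ => ?_
  change CharLaurentPolynomial.eval _ _ = _
  rw [CharLaurentPolynomial.eval_single, ← PrimitiveCharacter.sum_annihilator_eval,
    ← Finsupp.sum_finsetSum_index (fun χ => by simp) (fun χ m n => by push_cast; ring)]
  simp

end

variable {Γ : Type*} [Group Γ] [TopologicalSpace Γ] [DiscreteTopology Γ]

theorem inertiaImage_conjLocalHom {p : ℕ} [Fact p.Prime] (γ : Γ) (φ : LocalHom p Γ) :
    inertiaImage (conjLocalHom γ φ) = (inertiaImage φ).map (MulAut.conj γ).toMonoidHom := by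
  rw [inertiaImage, inertiaImage, Subgroup.map_map]
  rfl

/-- Conjugating the homomorphism conjugates its inertia image, so properness and conjugation
invariance together reduce the dependence to the class. -/
theorem CountingFunction.IsProper.exists_exponent {c : CountingFunction Γ} (hc : c.IsProper) :
    ∃ e : CyclicSubgroupClass Γ → ℤ, ∀ (p : ℕ) [Fact p.Prime], ¬ p ∣ Nat.card Γ →
      ∀ (φ : LocalHom p Γ) (x : Γ), inertiaImage φ = Subgroup.zpowers x →
        c.toFun p φ = e (CyclicSubgroupClass.ofGenerator x) := by
  have h : ∀ C : CyclicSubgroupClass Γ, ∃ m : ℤ, ∀ (p : ℕ) [Fact p.Prime], ¬ p ∣ Nat.card Γ →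
      ∀ (φ : LocalHom p Γ) (x : Γ), inertiaImage φ = Subgroup.zpowers x →
        CyclicSubgroupClass.ofGenerator x = C → c.toFun p φ = m := by
    intro C
    by_cases hC : ∃ (p : ℕ) (_ : Fact p.Prime) (φ : LocalHom p Γ) (x : Γ), ¬ p ∣ Nat.card Γ ∧
      inertiaImage φ = Subgroup.zpowers x ∧ CyclicSubgroupClass.ofGenerator x = C
    · obtain ⟨q, hq, ψ, y, hqN, hψ, hy⟩ := hC
      refine ⟨c.toFun q ψ, fun p _ hp φ x hφ hx => ?_⟩
      obtain ⟨γ, hγ⟩ := CyclicSubgroupClass.ofGenerator_eq_iff.1 (hx.trans hy.symm)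
      rw [← c.map_conj p γ φ]
      refine hc p q hp hqN _ _ ?_
      rw [inertiaImage_conjLocalHom, hφ, hγ, hψ]
    -- For a class that no inertia image meets the condition is empty, and `0` is a mere default.
    · exact ⟨0, fun p hpp hp φ x hφ hx => absurd ⟨p, hpp, φ, x, hp, hφ, hx⟩ hC⟩
  choose e he using h
  exact ⟨e, fun p _ hp φ x hφ => he _ p hp φ x hφ rfl⟩

variable [Finite Γ]

theorem finite_localHom {p : ℕ} [Fact p.Prime] (hp : ¬ p ∣ Nat.card Γ) :
    Finite (LocalHom p Γ) := by
  obtain ⟨T⟩ := nonempty_tameGenerators hp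
  exact Finite.of_equiv _ (T.localHomEquiv hp).symm

open Classical in
-- Group the pairs `(x, y)` by the class of `⟨x⟩`: the summand is constant on each group, and the
-- factor `|Γ|` in its size cancels the normalization of the mass.
theorem totalMass_eq_sum {c : CountingFunction Γ} {e : CyclicSubgroupClass Γ → ℤ} {p : ℕ}
    [Fact p.Prime] (hp : ¬ p ∣ Nat.card Γ) (hcop : p.Coprime (Nat.card Γ))
    (he : ∀ (φ : LocalHom p Γ) (x : Γ), inertiaImage φ = Subgroup.zpowers x →
      c.toFun p φ = e (CyclicSubgroupClass.ofGenerator x)) :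
    c.totalMass p = ∑ C : CyclicSubgroupClass Γ,
      (if ZMod.unitOfCoprime p hcop ∈ C.powSubgroup then (C.powSubgroup.index : ℚ) else 0) *
        (p : ℚ) ^ (-e C) := by
  obtain ⟨T⟩ := nonempty_tameGenerators hp
  have hfin := finite_localHom (Γ := Γ) hp
  have := Fintype.ofFinite (LocalHom p Γ)
  have := Fintype.ofFinite {z : Γ × Γ // z.2 * z.1 * z.2⁻¹ = z.1 ^ p}
  have hN : (Nat.card Γ : ℚ) ≠ 0 := Nat.cast_ne_zero.2 Nat.card_pos.ne'
  have hsum : ∑ φ : LocalHom p Γ, 1 / (p : ℚ) ^ c.toFun p φ =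
      ∑ z : {z : Γ × Γ // z.2 * z.1 * z.2⁻¹ = z.1 ^ p},
        (p : ℚ) ^ (-e (CyclicSubgroupClass.ofGenerator z.1.1)) := by
    refine Fintype.sum_equiv (T.localHomEquiv hp) _ _ fun φ => ?_
    rw [he φ (φ T.τ) (T.inertiaImage_eq hp φ), one_div, ← zpow_neg]
    rfl
  rw [CountingFunction.totalMass, finsum_eq_sum_of_fintype, hsum,
    ← Finset.sum_fiberwise (s := Finset.univ)
      (g := fun z : {z : Γ × Γ // z.2 * z.1 * z.2⁻¹ = z.1 ^ p} =>
        CyclicSubgroupClass.ofGenerator z.1.1), Finset.mul_sum]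
  refine Finset.sum_congr rfl fun C _ => ?_
  have hcard : (Finset.univ.filter fun z : {z : Γ × Γ // z.2 * z.1 * z.2⁻¹ = z.1 ^ p} =>
      CyclicSubgroupClass.ofGenerator z.1.1 = C).card = Nat.card Γ *
        if ZMod.unitOfCoprime p hcop ∈ C.powSubgroup then C.powSubgroup.index else 0 := by
    rw [← C.card_pairs, ← Fintype.card_subtype, ← Nat.card_eq_fintype_card]
    refine Nat.card_congr ((Equiv.subtypeSubtypeEquivSubtypeInter
      (fun z : Γ × Γ => z.2 * z.1 * z.2⁻¹ = z.1 ^ p)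
      (fun z => CyclicSubgroupClass.ofGenerator z.1 = C)).trans
        (Equiv.subtypeEquivRight fun z => ?_))
    rw [ZMod.coe_unitOfCoprime, zmodPow_natCast]
  have hterm : ∀ z ∈ (Finset.univ.filter fun z : {z : Γ × Γ // z.2 * z.1 * z.2⁻¹ = z.1 ^ p} =>
      CyclicSubgroupClass.ofGenerator z.1.1 = C),
      (p : ℚ) ^ (-e (CyclicSubgroupClass.ofGenerator z.1.1)) = (p : ℚ) ^ (-e C) := by
    intro z hz
    rw [(Finset.mem_filter.1 hz).2]
  rw [Finset.sum_congr rfl hterm, Finset.sum_const, hcard, nsmul_eq_mul]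
  push_cast
  rw [← mul_assoc, ← mul_assoc, one_div, inv_mul_cancel₀ hN, one_mul]

theorem isTameMassFormula_massFormula {c : CountingFunction Γ} {e : CyclicSubgroupClass Γ → ℤ}
    (he : ∀ (p : ℕ) [Fact p.Prime], ¬ p ∣ Nat.card Γ → ∀ (φ : LocalHom p Γ) (x : Γ),
      inertiaImage φ = Subgroup.zpowers x →
        c.toFun p φ = e (CyclicSubgroupClass.ofGenerator x)) :
    c.IsTameMassFormula (massFormula e) := by
  intro p hpp hp
  have hcop := (Nat.Prime.coprime_iff_not_dvd hpp.out).2 hp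
  rw [eval_massFormula e hcop, totalMass_eq_sum hp hcop (he p hp)]
  push_cast
  refine Finset.sum_congr rfl fun C _ => ?_
  split_ifs <;> simp

theorem CountingFunction.IsTameMassFormula.unique {c : CountingFunction Γ}
    {f g : CharLaurentPolynomial (Nat.card Γ)} (hf : c.IsTameMassFormula f)
    (hg : c.IsTameMassFormula g) : f = g := by
  rw [← sub_eq_zero]
  refine CharLaurentPolynomial.eq_zero_of_eval_prime_eq_zero fun p hp hpN => ?_
  have : Fact p.Prime := ⟨hp⟩
  change CharLaurentPolynomial.evalHom (p : ℤ) (f - g) = 0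
  rw [map_sub, sub_eq_zero]
  exact (hf p hpN).symm.trans (hg p hpN)

end MassFormula

end

theorem theorem5p1 {Γ : Type*} [Group Γ] [Finite Γ] [TopologicalSpace Γ] [DiscreteTopology Γ]
    (c : CountingFunction Γ) (hc : c.IsProper) :
    (∀ (p : ℕ) [Fact p.Prime], ¬ p ∣ Nat.card Γ → Finite (LocalHom p Γ)) ∧
    (∃! f : CharLaurentPolynomial (Nat.card Γ), c.IsTameMassFormula f) ∧
    ∀ f : CharLaurentPolynomial (Nat.card Γ), c.IsTameMassFormula f →
      ∃ (i : CyclicSubgroupClass Γ → ℤ)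
        (A : CyclicSubgroupClass Γ → Finset (PrimitiveCharacter (Nat.card Γ))),
        (∀ C, PrimitiveCharacter.trivial (Nat.card Γ) ∈ A C) ∧
        f = ∑ C : CyclicSubgroupClass Γ,
          Finsupp.single (i C) (∑ χ ∈ A C, Finsupp.single χ (1 : ℤ)) := by
  obtain ⟨e, he⟩ := hc.exists_exponent
  have hmass := isTameMassFormula_massFormula he
  exact ⟨fun p _ hp => finite_localHom hp, ⟨massFormula e, hmass, fun f hf => hf.unique hmass⟩,
    fun f hf => ⟨e, fun C => PrimitiveCharacter.annihilator C.powSubgroup,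
      fun C => PrimitiveCharacter.trivial_mem_annihilator _, hf.unique hmass⟩⟩
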